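/- Let $n$ be a dimension and $\alpha$ a real number. There are constants $\varepsilon\in(0,1)$, $C_1>0$ and $C_2>0$, depending only on $n$ and $\alpha$, with the following property. Let $(M,g)$ be a smooth $n$-dimensional Riemannian manifold without boundary and $\Omega\subseteq M$ an open set (for instance $\Omega=M$, or a geodesic ball) on which $\mathrm{Ric}\ge -Kg$ for a constant $K\ge 0$. Let $c$ be a real constant such that one of the following two cases holds: (1) $c<0$ and $\alpha>0$; (2) $c>0$, $n\ge 3$ and $$\frac{n+2}{2(n-1)}<\alpha<\frac{2n^2+9n+6}{2n(n+2)}.$$ Let $u$ be a positive function of class $C^3$ on $\Omega$ (for instance a smooth one) which solves $$\Delta u+c\,u^{\alpha}=0\quad\text{on }\Omega ,$$ where $\Delta$ is the Laplace–Beltrami operator. Then $h=u^{\varepsilon}$ satisfies, at every point of $\Omega$, $$\tfrac12\,\Delta|\nabla h|^2\;\ge\; C_1\,\frac{|\nabla h|^4}{h^2}\;-\;C_2\,\Big\langle \frac{\nabla h}{h},\,\nabla|\nabla h|^2\Big\rangle\;-\;K\,|\nabla h|^2 .$$ -/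

import Mathlib

open Bundle
open scoped Manifold ContDiff

noncomputable section

namespace RiemGeom

/-! ### Local tensor calculus

The metric is given in local coordinates by a field `G` of symmetric positive definite matrices
`(g_{ij})` on (an open subset of) `ℝⁿ`. -/

/-- The `i`-th partial derivative of `f : ℝⁿ → ℝ` at `y`. -/
def partialD {n : ℕ} (i : Fin n) (f : EuclideanSpace ℝ (Fin n) → ℝ)
    (y : EuclideanSpace ℝ (Fin n)) : ℝ :=
  fderiv ℝ f y (EuclideanSpace.single i 1)

/-- The Christoffel symbol
`Γ^k_{ij} = ½ ∑ₗ g^{kl} (∂ᵢ g_{jl} + ∂ⱼ g_{il} - ∂ₗ g_{ij})` of the Levi-Civita connection. -/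
def christoffel {n : ℕ} (G : EuclideanSpace ℝ (Fin n) → Matrix (Fin n) (Fin n) ℝ)
    (k i j : Fin n) (y : EuclideanSpace ℝ (Fin n)) : ℝ :=
  (1 / 2) * ∑ l, (G y)⁻¹ k l *
    (partialD i (fun z => G z j l) y + partialD j (fun z => G z i l) y
      - partialD l (fun z => G z i j) y)

/-- The components of the Ricci tensor,
`R_{ij} = ∑ₖ (∂ₖ Γ^k_{ij} - ∂ⱼ Γ^k_{ik}) + ∑ₖₗ (Γ^k_{kl} Γ^l_{ij} - Γ^k_{jl} Γ^l_{ik})`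
(positive on round spheres). -/
def ricciCoord {n : ℕ} (G : EuclideanSpace ℝ (Fin n) → Matrix (Fin n) (Fin n) ℝ)
    (i j : Fin n) (y : EuclideanSpace ℝ (Fin n)) : ℝ :=
  ∑ k, (partialD k (christoffel G k i j) y - partialD j (christoffel G k i k) y)
    + ∑ k, ∑ l, (christoffel G k k l y * christoffel G l i j y
        - christoffel G k j l y * christoffel G l i k y)

/-- The components `∂ᵢ∂ⱼ f - ∑ₖ Γ^k_{ij} ∂ₖ f` of the covariant Hessian. -/
def hessianCoord {n : ℕ} (G : EuclideanSpace ℝ (Fin n) → Matrix (Fin n) (Fin n) ℝ)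
    (f : EuclideanSpace ℝ (Fin n) → ℝ) (i j : Fin n) (y : EuclideanSpace ℝ (Fin n)) : ℝ :=
  partialD i (partialD j f) y - ∑ k, christoffel G k i j y * partialD k f y

/-- The Laplace-Beltrami operator `∑ᵢⱼ g^{ij} (∇²f)_{ij}` (the trace of the Hessian). -/
def laplacianCoord {n : ℕ} (G : EuclideanSpace ℝ (Fin n) → Matrix (Fin n) (Fin n) ℝ)
    (f : EuclideanSpace ℝ (Fin n) → ℝ) (y : EuclideanSpace ℝ (Fin n)) : ℝ :=
  ∑ i, ∑ j, (G y)⁻¹ i j * hessianCoord G f i j y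

/-! ### Riemannian manifolds -/

variable {n : ℕ} {M : Type*} [TopologicalSpace M] [ChartedSpace (EuclideanSpace ℝ (Fin n)) M]

variable (n) in
/-- The `i`-th coordinate vector field of the chart around `x`, at the point with coordinates `y`. -/
def coordVector (x : M) (y : EuclideanSpace ℝ (Fin n)) (i : Fin n) :
    TangentSpace (𝓡 n) ((extChartAt (𝓡 n) x).symm y) :=
  mfderiv (𝓡 n) (𝓡 n) (extChartAt (𝓡 n) x).symm y
    (EuclideanSpace.single i 1 : EuclideanSpace ℝ (Fin n))

variable [RiemannianBundle (fun x : M => TangentSpace (𝓡 n) x)]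

variable (n) in
/-- The metric coefficients `g_{ij} = ⟨∂ᵢ, ∂ⱼ⟩` in the chart around `x`. -/
def chartMetric (x : M) (y : EuclideanSpace ℝ (Fin n)) : Matrix (Fin n) (Fin n) ℝ :=
  Matrix.of fun i j => inner ℝ (coordVector n x y i) (coordVector n x y j)

variable (n) in
/-- The Riemannian gradient: the vector `∇f(x)` with `⟨∇f(x), v⟩ = df(x) v` for all `v`. -/
def grad (f : M → ℝ) (x : M) : TangentSpace (𝓡 n) x :=
  haveI : FiniteDimensional ℝ (TangentSpace (𝓡 n) x) :=
    inferInstanceAs (FiniteDimensional ℝ (EuclideanSpace ℝ (Fin n)))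
  haveI : CompleteSpace (TangentSpace (𝓡 n) x) := FiniteDimensional.complete ℝ _
  (InnerProductSpace.toDual ℝ (TangentSpace (𝓡 n) x)).symm (mfderiv (𝓡 n) 𝓘(ℝ, ℝ) f x)

/-- The defining property of the gradient. -/
theorem inner_grad (f : M → ℝ) (x : M) (v : TangentSpace (𝓡 n) x) :
    inner ℝ (grad n f x) v = mfderiv (𝓡 n) 𝓘(ℝ, ℝ) f x v := by
  have : FiniteDimensional ℝ (TangentSpace (𝓡 n) x) :=
    inferInstanceAs (FiniteDimensional ℝ (EuclideanSpace ℝ (Fin n)))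
  have : CompleteSpace (TangentSpace (𝓡 n) x) := FiniteDimensional.complete ℝ _
  exact InnerProductSpace.toDual_symm_apply

variable (n) in
/-- The Laplace-Beltrami operator on functions `f : M → ℝ`, computed at `x` in the chart
around `x`. -/
def laplacian (f : M → ℝ) (x : M) : ℝ :=
  laplacianCoord (chartMetric n x) (f ∘ (extChartAt (𝓡 n) x).symm) (extChartAt (𝓡 n) x x)

/-- The `i`-th component of a tangent vector at `x` in the coordinate basis of the chart
around `x`. -/
def tangentCoord (x : M) (v : TangentSpace (𝓡 n) x) (i : Fin n) : ℝ :=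
  EuclideanSpace.proj (𝕜 := ℝ) i (mfderiv (𝓡 n) (𝓡 n) (extChartAt (𝓡 n) x) x v)

/-- The Ricci curvature `Ric(v, w) = ∑ᵢⱼ R_{ij} vⁱ wʲ` at `x`. -/
def ricci (x : M) (v w : TangentSpace (𝓡 n) x) : ℝ :=
  ∑ i, ∑ j, ricciCoord (chartMetric n x) i j (extChartAt (𝓡 n) x x)
    * tangentCoord x v i * tangentCoord x w j

end RiemGeom

end

/-! This is the Bernstein method. Put `h = u ^ ε`, `q = u ^ (α - 1)`, `a = (1 - ε) / ε` and `X =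
|∇h|² / h²`. The equation for `u` becomes `Δh = -ε c q h - a |∇h|² / h`. Bochner's formula
(`IsMetricOn.bochner`) writes `½ Δ|∇h|²` as `|∇²h|² + ⟨∇h, ∇Δh⟩ + Ric(∇h, ∇h)`. The first term is at
least `(Δh)² / n` (`IsMetricOn.laplacianCoord_sq_le`), the last at least `-K |∇h|²`, and the middle
one follows by differentiating the expression for `Δh`. Up to `-a ⟨∇h / h, ∇|∇h|²⟩ - K |∇h|²`, what
remains is `h²` times `(ε c q + a X)² / n - (α + ε - 1) c q X + a X²`.

It remains to choose `ε` so that this is at least `a X²` (`exists_exponent`). If `α n < n + 4`, the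
choice `ε = 1 - α n / (n + 4)` turns the first two terms into the perfect square `(ε c q - a X)² /
n`. If `α n ≥ n + 4`, the bounds on `α` leave only `c < 0`, and with `ε = 1/2` each term is
nonnegative. Hence `C₁ = C₂ = a`.

The calculation is done in the chart around the point considered. The Laplacian at each point is
defined through the chart around that very point, so differentiating the equation requires it in one
fixed chart on a neighbourhood. This is why the invariance of the Laplacian under coordinate changes
is proved (`IsMetricOn.laplacianCoord_comp`, `laplacian_eq_laplacianCoord`). The Ricci bound is used
only at the centre of the chart and needs no such transfer. -/

namespace RiemGeom

/-! ### Partial derivatives of functions on `ℝⁿ`. -/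

section CoordinateCalculus

variable {n : ℕ} {f g : EuclideanSpace ℝ (Fin n) → ℝ} {y : EuclideanSpace ℝ (Fin n)} (i j : Fin n)

theorem partialD_congr (h : f =ᶠ[nhds y] g) : partialD i f y = partialD i g y := by
  simp only [partialD, h.fderiv_eq]

theorem partialD_congr_on {U : Set (EuclideanSpace ℝ (Fin n))} (hU : IsOpen U) (hy : y ∈ U)
    (h : ∀ z ∈ U, f z = g z) : partialD i f y = partialD i g y :=
  partialD_congr i (Filter.eventuallyEq_of_mem (hU.mem_nhds hy) h)

theorem partialD_add (hf : DifferentiableAt ℝ f y) (hg : DifferentiableAt ℝ g y) :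
    partialD i (fun z => f z + g z) y = partialD i f y + partialD i g y := by
  simp only [partialD, fderiv_fun_add hf hg, _root_.add_apply]

theorem partialD_sub (hf : DifferentiableAt ℝ f y) (hg : DifferentiableAt ℝ g y) :
    partialD i (fun z => f z - g z) y = partialD i f y - partialD i g y := by
  simp only [partialD, fderiv_fun_sub hf hg, _root_.sub_apply]

theorem partialD_mul (hf : DifferentiableAt ℝ f y) (hg : DifferentiableAt ℝ g y) :
    partialD i (fun z => f z * g z) y = partialD i f y * g y + f y * partialD i g y := by
  simp only [partialD, fderiv_fun_mul hf hg, _root_.add_apply,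
    _root_.smul_apply, smul_eq_mul]
  ring

theorem partialD_const_mul (c : ℝ) (hf : DifferentiableAt ℝ f y) :
    partialD i (fun z => c * f z) y = c * partialD i f y := by
  simp only [partialD, fderiv_const_mul hf c, _root_.smul_apply, smul_eq_mul]

theorem partialD_sum {ι : Type*} (s : Finset ι) {F : ι → EuclideanSpace ℝ (Fin n) → ℝ}
    (hF : ∀ k, DifferentiableAt ℝ (F k) y) :
    partialD i (fun z => ∑ k ∈ s, F k z) y = ∑ k ∈ s, partialD i (F k) y := by
  simp only [partialD, fderiv_fun_sum fun k _ => hF k, _root_.sum_apply]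

theorem partialD_comp {ψ : ℝ → ℝ} {ψ' : ℝ} (hψ : HasDerivAt ψ ψ' (f y))
    (hf : DifferentiableAt ℝ f y) :
    partialD i (fun z => ψ (f z)) y = ψ' * partialD i f y := by
  have := (hψ.comp_hasFDerivAt y hf.hasFDerivAt).fderiv
  simp only [partialD]
  rw [show (fun z => ψ (f z)) = ψ ∘ f from rfl, this]
  simp

theorem partialD_comm (hf : ContDiffAt ℝ 2 f y) :
    partialD i (partialD j f) y = partialD j (partialD i f) y := by
  have hd : DifferentiableAt ℝ (fderiv ℝ f) y :=
    (hf.fderiv_right (m := 1) (by norm_num)).differentiableAt (by norm_num)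
  have key : ∀ a b : Fin n, partialD a (partialD b f) y =
      fderiv ℝ (fderiv ℝ f) y (EuclideanSpace.single a 1) (EuclideanSpace.single b 1) := by
    intro a b
    unfold partialD
    rw [fderiv_clm_apply hd (differentiableAt_const _)]
    simp
  rw [key, key]
  exact hf.isSymmSndFDerivAt (by simp) _ _

theorem contDiffOn_partialD {U : Set (EuclideanSpace ℝ (Fin n))} {m k : ℕ∞ω} (hU : IsOpen U)
    (hf : ContDiffOn ℝ k f U) (hmk : m + 1 ≤ k) : ContDiffOn ℝ m (partialD i f) U :=
  (hf.fderiv_of_isOpen hU hmk).clm_apply contDiffOn_const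

theorem fderiv_apply_eq_sum_partialD (v : EuclideanSpace ℝ (Fin n)) :
    fderiv ℝ f y v = ∑ k, v k * partialD k f y := by
  conv_lhs => rw [← (EuclideanSpace.basisFun (Fin n) ℝ).sum_repr v]
  simp [partialD]

end CoordinateCalculus

/-! ### Metrics in coordinates and the Levi-Civita connection. -/

/-- A smooth Riemannian metric on an open subset of `ℝⁿ`, given by its coefficients. -/
structure IsMetricOn {n : ℕ} (G : EuclideanSpace ℝ (Fin n) → Matrix (Fin n) (Fin n) ℝ)
    (U : Set (EuclideanSpace ℝ (Fin n))) : Prop where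
  isOpen : IsOpen U
  contDiffOn : ∀ i j, ContDiffOn ℝ ∞ (fun y => G y i j) U
  posDef : ∀ y ∈ U, (G y).PosDef

/-- The contravariant components `g^{ij} ∂ⱼ f` of the gradient. -/
noncomputable def gradCoord {n : ℕ} (G : EuclideanSpace ℝ (Fin n) → Matrix (Fin n) (Fin n) ℝ)
    (f : EuclideanSpace ℝ (Fin n) → ℝ) (i : Fin n) (y : EuclideanSpace ℝ (Fin n)) : ℝ :=
  ∑ j, (G y)⁻¹ i j * partialD j f y

/-- The inner product `g^{ij} ∂ᵢ f ∂ⱼ h` of two gradients. -/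
noncomputable def innerGradCoord {n : ℕ} (G : EuclideanSpace ℝ (Fin n) → Matrix (Fin n) (Fin n) ℝ)
    (f h : EuclideanSpace ℝ (Fin n) → ℝ) (y : EuclideanSpace ℝ (Fin n)) : ℝ :=
  ∑ i, ∑ j, (G y)⁻¹ i j * partialD i f y * partialD j h y

/-- The covariant derivative `∂ₖ Xⁱ + ∑ⱼ Γⁱ_{kj} Xʲ` of a vector field. -/
noncomputable def covDeriv {n : ℕ} (G : EuclideanSpace ℝ (Fin n) → Matrix (Fin n) (Fin n) ℝ)
    (X : Fin n → EuclideanSpace ℝ (Fin n) → ℝ) (k i : Fin n) (y : EuclideanSpace ℝ (Fin n)) : ℝ :=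
  partialD k (X i) y + ∑ j, christoffel G i k j y * X j y

theorem contDiffOn_det {E : Type*} [NormedAddCommGroup E] [NormedSpace ℝ E] {n : ℕ} {k : ℕ∞ω}
    {A : E → Matrix (Fin n) (Fin n) ℝ} {U : Set E}
    (hA : ∀ i j, ContDiffOn ℝ k (fun y => A y i j) U) :
    ContDiffOn ℝ k (fun y => (A y).det) U := by
  simp only [Matrix.det_apply]
  exact ContDiffOn.sum fun σ _ =>
    (contDiffOn_prod fun i _ => hA (σ i) i).const_smul (Equiv.Perm.sign σ)

theorem contDiffOn_adjugate {E : Type*} [NormedAddCommGroup E] [NormedSpace ℝ E] {n : ℕ} {k : ℕ∞ω}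
    {A : E → Matrix (Fin n) (Fin n) ℝ} {U : Set E}
    (hA : ∀ i j, ContDiffOn ℝ k (fun y => A y i j) U) (i j : Fin n) :
    ContDiffOn ℝ k (fun y => (A y).adjugate i j) U := by
  simp only [Matrix.adjugate_apply]
  refine contDiffOn_det fun a b => ?_
  by_cases hab : a = j
  · subst hab
    simpa using contDiffOn_const
  · simpa [Matrix.updateRow_ne hab] using hA a b

namespace IsMetricOn

variable {n : ℕ} {G : EuclideanSpace ℝ (Fin n) → Matrix (Fin n) (Fin n) ℝ}
  {U : Set (EuclideanSpace ℝ (Fin n))} {y : EuclideanSpace ℝ (Fin n)}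

section Metric

variable (hG : IsMetricOn G U)
include hG

theorem symm (hy : y ∈ U) (i j : Fin n) : G y i j = G y j i := by
  simpa using ((hG.posDef y hy).isHermitian.apply i j).symm

theorem mono {V : Set (EuclideanSpace ℝ (Fin n))} (hV : IsOpen V) (hVU : V ⊆ U) :
    IsMetricOn G V :=
  ⟨hV, fun i j => (hG.contDiffOn i j).mono hVU, fun y hy => hG.posDef y (hVU hy)⟩

theorem det_ne_zero (hy : y ∈ U) : (G y).det ≠ 0 := (hG.posDef y hy).det_pos.ne'

theorem mul_inv (hy : y ∈ U) : G y * (G y)⁻¹ = 1 :=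
  Matrix.mul_nonsing_inv _ (isUnit_iff_ne_zero.2 (hG.det_ne_zero hy))

theorem inv_mul (hy : y ∈ U) : (G y)⁻¹ * G y = 1 :=
  Matrix.nonsing_inv_mul _ (isUnit_iff_ne_zero.2 (hG.det_ne_zero hy))

theorem inv_symm (hy : y ∈ U) (i j : Fin n) : (G y)⁻¹ i j = (G y)⁻¹ j i := by
  simpa using ((hG.posDef y hy).isHermitian.inv.apply i j).symm

theorem sum_mul_inv_mul (hy : y ∈ U) (v : Fin n → ℝ) (i : Fin n) :
    ∑ k, G y i k * ∑ j, (G y)⁻¹ k j * v j = v i := by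
  have : (G y).mulVec ((G y)⁻¹.mulVec v) i = v i := by
    rw [Matrix.mulVec_mulVec, hG.mul_inv hy, Matrix.one_mulVec]
  exact this

theorem sum_inv_mul_mul (hy : y ∈ U) (v : Fin n → ℝ) (i : Fin n) :
    ∑ k, (G y)⁻¹ i k * ∑ j, G y k j * v j = v i := by
  have : (G y)⁻¹.mulVec ((G y).mulVec v) i = v i := by
    rw [Matrix.mulVec_mulVec, hG.inv_mul hy, Matrix.one_mulVec]
  exact this

theorem contDiffOn_inv (i j : Fin n) : ContDiffOn ℝ ∞ (fun y => (G y)⁻¹ i j) U := by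
  have : ∀ y, (G y)⁻¹ i j = (G y).det⁻¹ * (G y).adjugate i j := by
    intro y
    rw [Matrix.inv_def]
    simp
  simp only [this]
  exact ((contDiffOn_det hG.contDiffOn).inv fun y hy => hG.det_ne_zero hy).mul
    (contDiffOn_adjugate hG.contDiffOn i j)

theorem contDiffOn_christoffel (k i j : Fin n) : ContDiffOn ℝ ∞ (christoffel G k i j) U := by
  have hd : ∀ a b c, ContDiffOn ℝ ∞ (partialD a fun z => G z b c) U := fun a b c =>
    contDiffOn_partialD a hG.isOpen (hG.contDiffOn b c) (by simp)
  unfold christoffel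
  exact contDiffOn_const.mul (ContDiffOn.sum fun l _ =>
    (hG.contDiffOn_inv k l).mul (((hd _ _ _).add (hd _ _ _)).sub (hd _ _ _)))

theorem partialD_symm (hy : y ∈ U) (l i j : Fin n) :
    partialD l (fun z => G z i j) y = partialD l (fun z => G z j i) y :=
  partialD_congr_on l hG.isOpen hy fun _ hz => hG.symm hz i j

/-- Christoffel symbols of the first kind: contracting with `G` cancels the inverse metric in the
definition. -/
theorem sum_mul_christoffel (hy : y ∈ U) (m i j : Fin n) :
    ∑ k, G y m k * christoffel G k i j y = (1 / 2) * (partialD i (fun z => G z j m) y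
      + partialD j (fun z => G z i m) y - partialD m (fun z => G z i j) y) := by
  rw [← hG.sum_mul_inv_mul hy (fun m => (1 / 2) * (partialD i (fun z => G z j m) y
      + partialD j (fun z => G z i m) y - partialD m (fun z => G z i j) y)) m]
  refine Finset.sum_congr rfl fun k _ => ?_
  rw [christoffel, Finset.mul_sum]
  congr 1
  exact Finset.sum_congr rfl fun l _ => by ring

theorem christoffel_symm (hy : y ∈ U) (k i j : Fin n) :
    christoffel G k i j y = christoffel G k j i y := by
  unfold christoffel
  congr 1
  refine Finset.sum_congr rfl fun l _ => ?_
  rw [hG.partialD_symm hy l i j]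
  ring

/-- Metric compatibility `∇g = 0`: in the sum of two lowered Christoffel symbols all derivatives of
`G` but one cancel. -/
theorem partialD_metric (hy : y ∈ U) (l i j : Fin n) :
    partialD l (fun z => G z i j) y =
      ∑ k, (G y i k * christoffel G k l j y + G y j k * christoffel G k l i y) := by
  rw [Finset.sum_add_distrib, hG.sum_mul_christoffel hy, hG.sum_mul_christoffel hy,
    hG.partialD_symm hy l j i, hG.partialD_symm hy i l j, hG.partialD_symm hy j l i]
  ring

/-- Lowering an index commutes with covariant differentiation. -/
theorem sum_mul_covDeriv (hy : y ∈ U) {W w : Fin n → EuclideanSpace ℝ (Fin n) → ℝ}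
    (hW : ∀ i, DifferentiableAt ℝ (W i) y)
    (hw : ∀ i, ∀ z ∈ U, w i z = ∑ m, G z i m * W m z) (l i : Fin n) :
    ∑ m, G y i m * covDeriv G W l m y =
      partialD l (w i) y - ∑ p, christoffel G p l i y * w p y := by
  have hGd : ∀ a b, DifferentiableAt ℝ (fun z => G z a b) y := fun a b =>
    ((hG.contDiffOn a b).contDiffAt (hG.isOpen.mem_nhds hy)).differentiableAt (by simp)
  -- Product rule for `w = G W`, with the derivative of `G` expanded by `∇g = 0`; the terms in which
  -- `Γ` carries the index `i` are those removed by the covariant derivative of a covector.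
  have h1 : partialD l (w i) y = ∑ m, ((∑ k, (G y i k * christoffel G k l m y
      + G y m k * christoffel G k l i y)) * W m y + G y i m * partialD l (W m) y) := by
    rw [partialD_congr_on l hG.isOpen hy (hw i), partialD_sum l _ fun m => (hGd i m).fun_mul (hW m)]
    refine Finset.sum_congr rfl fun m _ => ?_
    rw [partialD_mul l (hGd i m) (hW m), hG.partialD_metric hy]
  have h2 : ∑ p, christoffel G p l i y * w p y
      = ∑ m, ∑ k, G y m k * christoffel G k l i y * W m y := by
    rw [Finset.sum_comm]
    refine Finset.sum_congr rfl fun p _ => ?_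
    rw [hw p y hy, Finset.mul_sum]
    refine Finset.sum_congr rfl fun m _ => ?_
    rw [hG.symm hy m p]
    ring
  have h3 : ∑ m, G y i m * ∑ j, christoffel G m l j y * W j y
      = ∑ m, ∑ k, G y i k * christoffel G k l m y * W m y := by
    rw [Finset.sum_comm]
    refine Finset.sum_congr rfl fun p _ => ?_
    rw [Finset.mul_sum]
    exact Finset.sum_congr rfl fun m _ => by ring
  simp only [h1, h2, covDeriv, mul_add, Finset.sum_add_distrib, h3, add_mul, Finset.sum_mul]
  ring

end Metric

/-! ### Gradient, Hessian and the first derivative of `|∇f|²`. -/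

section Bochner

variable (hG : IsMetricOn G U) {f : EuclideanSpace ℝ (Fin n) → ℝ}
include hG

theorem partialD_eq_sum_gradCoord (hy : y ∈ U) (i : Fin n) :
    partialD i f y = ∑ m, G y i m * gradCoord G f m y :=
  (hG.sum_mul_inv_mul hy (fun j => partialD j f y) i).symm

theorem innerGradCoord_eq (hy : y ∈ U) (h : EuclideanSpace ℝ (Fin n) → ℝ) :
    innerGradCoord G f h y = ∑ i, gradCoord G f i y * partialD i h y := by
  unfold innerGradCoord gradCoord
  rw [Finset.sum_comm]
  refine Finset.sum_congr rfl fun i _ => ?_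
  rw [Finset.sum_mul]
  refine Finset.sum_congr rfl fun j _ => ?_
  rw [hG.inv_symm hy i j]

theorem contDiffOn_gradCoord {m k : ℕ∞ω} (hf : ContDiffOn ℝ k f U) (hmk : m + 1 ≤ k)
    (hm : m ≤ ∞) (i : Fin n) : ContDiffOn ℝ m (gradCoord G f i) U := by
  unfold gradCoord
  exact ContDiffOn.sum fun j _ => ((hG.contDiffOn_inv i j).of_le hm).mul
    (contDiffOn_partialD j hG.isOpen hf hmk)

theorem contDiffOn_covDeriv {X : Fin n → EuclideanSpace ℝ (Fin n) → ℝ} {m k : ℕ∞ω}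
    (hX : ∀ i, ContDiffOn ℝ k (X i) U) (hmk : m + 1 ≤ k) (hm : m ≤ ∞) (i j : Fin n) :
    ContDiffOn ℝ m (covDeriv G X i j) U := by
  unfold covDeriv
  exact (contDiffOn_partialD i hG.isOpen (hX j) hmk).add (ContDiffOn.sum fun l _ =>
    ((hG.contDiffOn_christoffel j i l).of_le hm).mul ((hX l).of_le (le_self_add.trans hmk)))

theorem sum_mul_covDeriv_gradCoord (hf : ContDiffOn ℝ 2 f U) (hy : y ∈ U) (k i : Fin n) :
    ∑ m, G y i m * covDeriv G (gradCoord G f) k m y = hessianCoord G f k i y :=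
  hG.sum_mul_covDeriv hy (w := fun i => partialD i f)
    (fun i => ((hG.contDiffOn_gradCoord (m := 1) hf (by norm_num) (by simp) i).contDiffAt
      (hG.isOpen.mem_nhds hy)).differentiableAt (by simp))
    (fun i _ hz => hG.partialD_eq_sum_gradCoord hz i) k i

theorem hessianCoord_symm (hf : ContDiffOn ℝ 2 f U) (hy : y ∈ U) (i j : Fin n) :
    hessianCoord G f i j y = hessianCoord G f j i y := by
  unfold hessianCoord
  rw [partialD_comm i j (hf.contDiffAt (hG.isOpen.mem_nhds hy))]
  congr 1
  exact Finset.sum_congr rfl fun k _ => by rw [hG.christoffel_symm hy]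

theorem covDeriv_gradCoord_eq (hf : ContDiffOn ℝ 2 f U) (hy : y ∈ U) (k i : Fin n) :
    covDeriv G (gradCoord G f) k i y = ∑ l, (G y)⁻¹ i l * hessianCoord G f k l y := by
  simp only [← hG.sum_mul_covDeriv_gradCoord hf hy]
  exact (hG.sum_inv_mul_mul hy (fun m => covDeriv G (gradCoord G f) k m y) i).symm

/-- The Laplacian is the divergence of the gradient. -/
theorem laplacianCoord_eq_div (hf : ContDiffOn ℝ 2 f U) (hy : y ∈ U) :
    laplacianCoord G f y = ∑ l, covDeriv G (gradCoord G f) l l y := by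
  unfold laplacianCoord
  refine Finset.sum_congr rfl fun l _ => ?_
  rw [hG.covDeriv_gradCoord_eq hf hy]

theorem contDiffOn_innerGradCoord {h : EuclideanSpace ℝ (Fin n) → ℝ} {m k : ℕ∞ω}
    (hf : ContDiffOn ℝ k f U) (hh : ContDiffOn ℝ k h U) (hmk : m + 1 ≤ k) (hm : m ≤ ∞) :
    ContDiffOn ℝ m (innerGradCoord G f h) U := by
  unfold innerGradCoord
  exact ContDiffOn.sum fun i _ => ContDiffOn.sum fun j _ =>
    (((hG.contDiffOn_inv i j).of_le hm).mul (contDiffOn_partialD i hG.isOpen hf hmk)).mul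
      (contDiffOn_partialD j hG.isOpen hh hmk)

/-- In the product rule for `Xⁱ ∂ᵢf`, replacing each ordinary derivative by a covariant one costs a
Christoffel term. The two terms have opposite signs and cancel, and each factor contributes the same
Hessian term. -/
theorem partialD_innerGradCoord_self (hf : ContDiffOn ℝ 2 f U) (hy : y ∈ U) (k : Fin n) :
    partialD k (innerGradCoord G f f) y =
      2 * ∑ i, hessianCoord G f k i y * gradCoord G f i y := by
  have hX : ∀ i, DifferentiableAt ℝ (gradCoord G f i) y := fun i =>
    ((hG.contDiffOn_gradCoord (m := 1) hf (by norm_num) (by simp) i).contDiffAt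
      (hG.isOpen.mem_nhds hy)).differentiableAt (by simp)
  have hp : ∀ i, DifferentiableAt ℝ (partialD i f) y := fun i =>
    ((contDiffOn_partialD (m := 1) i hG.isOpen hf (by norm_num)).contDiffAt
      (hG.isOpen.mem_nhds hy)).differentiableAt (by simp)
  rw [partialD_congr_on k hG.isOpen hy fun z hz => hG.innerGradCoord_eq hz f,
    partialD_sum k _ fun i => (hX i).fun_mul (hp i)]
  have h1 : ∑ i, covDeriv G (gradCoord G f) k i y * partialD i f y
      = ∑ i, hessianCoord G f k i y * gradCoord G f i y := by
    simp only [← hG.sum_mul_covDeriv_gradCoord hf hy, hG.partialD_eq_sum_gradCoord hy,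
      Finset.mul_sum, Finset.sum_mul]
    rw [Finset.sum_comm]
    refine Finset.sum_congr rfl fun i _ => Finset.sum_congr rfl fun j _ => ?_
    rw [hG.symm hy i j]
    ring
  have h2 : ∑ i, (∑ j, christoffel G i k j y * gradCoord G f j y) * partialD i f y
      = ∑ i, (∑ j, christoffel G j k i y * partialD j f y) * gradCoord G f i y := by
    simp only [Finset.sum_mul]
    rw [Finset.sum_comm]
    exact Finset.sum_congr rfl fun i _ => Finset.sum_congr rfl fun j _ => by ring
  have h3 : ∑ i, partialD i f y * partialD k (gradCoord G f i) y
      = ∑ i, hessianCoord G f k i y * gradCoord G f i y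
        - ∑ i, (∑ j, christoffel G j k i y * partialD j f y) * gradCoord G f i y := by
    rw [← h1, ← h2, ← Finset.sum_sub_distrib]
    refine Finset.sum_congr rfl fun i _ => ?_
    rw [covDeriv]
    ring
  have h4 : ∑ i, gradCoord G f i y * partialD k (partialD i f) y
      = ∑ i, hessianCoord G f k i y * gradCoord G f i y
        + ∑ i, (∑ j, christoffel G j k i y * partialD j f y) * gradCoord G f i y := by
    rw [← Finset.sum_add_distrib]
    refine Finset.sum_congr rfl fun i _ => ?_
    rw [hessianCoord]
    ring
  have h5 : ∀ i, partialD k (fun z => gradCoord G f i z * partialD i f z) y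
      = gradCoord G f i y * partialD k (partialD i f) y
        + partialD i f y * partialD k (gradCoord G f i) y := by
    intro i
    rw [partialD_mul k (hX i) (hp i)]
    ring
  simp only [h5, Finset.sum_add_distrib, h3, h4]
  ring

end Bochner

end IsMetricOn

end RiemGeom

/-! ### The contracted Ricci identity and Bochner's formula. -/

namespace RiemGeom
/-- The second covariant derivative `∇ₗ∇ᵢ X^m` of a vector field. -/
noncomputable def covDeriv₂ {n : ℕ}
    (G : EuclideanSpace ℝ (Fin n) → Matrix (Fin n) (Fin n) ℝ)
    (X : Fin n → EuclideanSpace ℝ (Fin n) → ℝ) (l i m : Fin n) (y : EuclideanSpace ℝ (Fin n)) : ℝ :=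
  covDeriv G (fun m => covDeriv G X i m) l m y - ∑ j, christoffel G j l i y * covDeriv G X j m y

namespace IsMetricOn

variable {n : ℕ} {G : EuclideanSpace ℝ (Fin n) → Matrix (Fin n) (Fin n) ℝ}
  {U : Set (EuclideanSpace ℝ (Fin n))} {y : EuclideanSpace ℝ (Fin n)}

section Bochner

variable (hG : IsMetricOn G U) {f : EuclideanSpace ℝ (Fin n) → ℝ}
include hG

/-- The contracted Ricci identity. -/
theorem sum_covDeriv₂_comm {X : Fin n → EuclideanSpace ℝ (Fin n) → ℝ}
    (hX : ∀ i, ContDiffOn ℝ 2 (X i) U) (hy : y ∈ U) (i : Fin n) :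
    ∑ l, covDeriv₂ G X l i l y = partialD i (fun z => ∑ l, covDeriv G X l l z) y
      + ∑ p, ricciCoord G p i y * X p y := by
  have hU := hG.isOpen.mem_nhds hy
  have hXd : ∀ i, DifferentiableAt ℝ (X i) y := fun i =>
    ((hX i).contDiffAt hU).differentiableAt (by simp)
  have hpX : ∀ i j, DifferentiableAt ℝ (partialD i (X j)) y := fun i j =>
    ((contDiffOn_partialD (m := 1) i hG.isOpen (hX j) (by norm_num)).contDiffAt hU).differentiableAt
      (by simp)
  have hΓ : ∀ k i j, DifferentiableAt ℝ (christoffel G k i j) y := fun k i j =>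
    ((hG.contDiffOn_christoffel k i j).contDiffAt hU).differentiableAt (by simp)
  have hT : ∀ i m, DifferentiableAt ℝ (covDeriv G X i m) y := fun i m =>
    ((hG.contDiffOn_covDeriv (m := 1) hX (by norm_num) (by simp) i m).contDiffAt
      hU).differentiableAt (by simp)
  have hpT : ∀ l i m, partialD l (covDeriv G X i m) y = partialD l (partialD i (X m)) y
      + ∑ j, (partialD l (christoffel G m i j) y * X j y
        + christoffel G m i j y * partialD l (X j) y) := by
    intro l i m
    have := partialD_add l (hpX i m)
      (DifferentiableAt.fun_sum (u := Finset.univ) fun j _ => (hΓ m i j).fun_mul (hXd j))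
    rw [partialD_sum l _ fun j => (hΓ m i j).fun_mul (hXd j)] at this
    simp only [partialD_mul l (hΓ m i _) (hXd _)] at this
    exact this
  rw [partialD_sum i _ fun l => hT l l]
  have hR : ∑ p, ricciCoord G p i y * X p y
      = ∑ l, (∑ p, (partialD l (christoffel G l i p) y - partialD i (christoffel G l l p) y) * X p y
        + ∑ p, ∑ q, (christoffel G l l q y * christoffel G q i p y
          - christoffel G l i q y * christoffel G q l p y) * X p y) := by
    rw [Finset.sum_add_distrib, Finset.sum_comm]
    nth_rw 2 [Finset.sum_comm]
    rw [← Finset.sum_add_distrib]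
    refine Finset.sum_congr rfl fun p _ => ?_
    unfold ricciCoord
    rw [add_mul, Finset.sum_mul, Finset.sum_mul]
    congr 1
    · refine Finset.sum_congr rfl fun l _ => ?_
      rw [partialD_congr_on l hG.isOpen hy fun z hz => hG.christoffel_symm hz l p i,
        partialD_congr_on i hG.isOpen hy fun z hz => hG.christoffel_symm hz l p l]
    · refine Finset.sum_congr rfl fun l _ => ?_
      rw [Finset.sum_mul]
      refine Finset.sum_congr rfl fun q _ => ?_
      rw [hG.christoffel_symm hy q p i, hG.christoffel_symm hy q p l]
  rw [hR, ← Finset.sum_add_distrib]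
  -- `e1` and `e2` expand both sides for fixed `l`. They differ only in the last correction term,
  -- `Γ^j_{li} ∇ⱼX^l` against `Γ^l_{ij} ∇ₗX^j`; these agree after summing over both indices, by
  -- renaming and symmetry of `Γ`.
  have e1 : ∀ l, covDeriv₂ G X l i l y = partialD i (partialD l (X l)) y
      + ∑ p, partialD l (christoffel G l i p) y * X p y
      + ∑ p, christoffel G l i p y * partialD l (X p) y
      + ∑ p, christoffel G l l p y * partialD i (X p) y
      + ∑ p, ∑ q, christoffel G l l q y * christoffel G q i p y * X p y
      - ∑ j, christoffel G j l i y * covDeriv G X j l y := by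
    intro l
    have : ∑ p, ∑ q, christoffel G l l q y * christoffel G q i p y * X p y
        = ∑ q, christoffel G l l q y * ∑ p, christoffel G q i p y * X p y := by
      rw [Finset.sum_comm]
      refine Finset.sum_congr rfl fun p _ => ?_
      rw [Finset.mul_sum]
      exact Finset.sum_congr rfl fun q _ => by ring
    rw [covDeriv₂, covDeriv, hpT, partialD_comm l i ((hX l).contDiffAt hU), this]
    simp only [covDeriv, mul_add, Finset.sum_add_distrib]
    ring
  have e2 : ∀ l, partialD i (covDeriv G X l l) y
      + (∑ p, (partialD l (christoffel G l i p) y - partialD i (christoffel G l l p) y) * X p y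
        + ∑ p, ∑ q, (christoffel G l l q y * christoffel G q i p y
          - christoffel G l i q y * christoffel G q l p y) * X p y)
      = partialD i (partialD l (X l)) y
      + ∑ p, partialD l (christoffel G l i p) y * X p y
      + ∑ p, christoffel G l i p y * partialD l (X p) y
      + ∑ p, christoffel G l l p y * partialD i (X p) y
      + ∑ p, ∑ q, christoffel G l l q y * christoffel G q i p y * X p y
      - ∑ j, christoffel G l i j y * covDeriv G X l j y := by
    intro l
    have : ∑ p, ∑ q, christoffel G l i q y * christoffel G q l p y * X p y
        = ∑ q, christoffel G l i q y * ∑ p, christoffel G q l p y * X p y := by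
      rw [Finset.sum_comm]
      refine Finset.sum_congr rfl fun p _ => ?_
      rw [Finset.mul_sum]
      exact Finset.sum_congr rfl fun q _ => by ring
    simp only [hpT, covDeriv, mul_add, sub_mul, Finset.sum_add_distrib, Finset.sum_sub_distrib,
      this]
    ring
  simp only [e1, e2, Finset.sum_sub_distrib]
  congr 1
  rw [Finset.sum_comm]
  exact Finset.sum_congr rfl fun j _ => Finset.sum_congr rfl fun l _ => by
    rw [hG.christoffel_symm hy j l i]

/-- **Bochner's formula** in local coordinates. -/
theorem bochner (hf : ContDiffOn ℝ 3 f U) (hy : y ∈ U) :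
    (1 / 2) * laplacianCoord G (innerGradCoord G f f) y =
      ∑ i, ∑ l, covDeriv G (gradCoord G f) i l y * covDeriv G (gradCoord G f) l i y
      + innerGradCoord G f (laplacianCoord G f) y
      + ∑ i, ∑ j, ricciCoord G i j y * gradCoord G f i y * gradCoord G f j y := by
  have hU := hG.isOpen.mem_nhds hy
  have hf2 : ContDiffOn ℝ 2 f U := hf.of_le (by norm_num)
  set X := gradCoord G f with hXdef
  have hX : ∀ i, ContDiffOn ℝ 2 (X i) U := fun i =>
    hG.contDiffOn_gradCoord (m := 2) hf (by norm_num) (WithTop.coe_le_coe.2 le_top) i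
  have hXd : ∀ i, DifferentiableAt ℝ (X i) y := fun i =>
    ((hX i).contDiffAt hU).differentiableAt (by simp)
  have hT : ∀ i m, DifferentiableAt ℝ (covDeriv G X i m) y := fun i m =>
    ((hG.contDiffOn_covDeriv (m := 1) hX (by norm_num) (by simp) i m).contDiffAt
      hU).differentiableAt (by simp)
  have hΓ : ∀ k i j, ContDiffOn ℝ 1 (christoffel G k i j) U := fun k i j =>
    (hG.contDiffOn_christoffel k i j).of_le (by simp)
  have hH : ∀ i j, DifferentiableAt ℝ (hessianCoord G f i j) y := by
    intro i j
    refine ContDiffAt.differentiableAt (n := 1) (ContDiffOn.contDiffAt (s := U) ?_ hU) (by simp)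
    exact (contDiffOn_partialD i hG.isOpen (contDiffOn_partialD (m := 2) j hG.isOpen hf
      (by norm_num)) (by norm_num)).sub (ContDiffOn.sum fun k _ => (hΓ k i j).mul
        (contDiffOn_partialD k hG.isOpen hf2 (by norm_num)))
  -- the covariant derivative of the Hessian
  let N : Fin n → Fin n → Fin n → ℝ := fun l k i => partialD l (hessianCoord G f k i) y
    - ∑ j, christoffel G j l i y * hessianCoord G f k j y
    - ∑ j, christoffel G j l k y * hessianCoord G f j i y
  -- `N l k i` is `∇ₗ∇ₖ∇ᵢf`; the symmetry of the Hessian passes to its covariant derivative.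
  have hN : ∀ l k i, N l k i = N l i k := by
    intro l k i
    simp only [N]
    rw [partialD_congr_on l hG.isOpen hy fun z hz => hG.hessianCoord_symm hf2 hz k i]
    simp only [hG.hessianCoord_symm hf2 hy k, hG.hessianCoord_symm hf2 hy _ i]
    ring
  have hNX : ∀ l i k, N l i k = ∑ m, G y k m * covDeriv₂ G X l i m y := by
    intro l i k
    have h1 := hG.sum_mul_covDeriv hy (W := fun m => covDeriv G X i m)
      (w := fun k => hessianCoord G f i k) (hT i)
      (fun k z hz => (hG.sum_mul_covDeriv_gradCoord hf2 hz i k).symm) l k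
    have h2 : ∑ m, G y k m * ∑ j, christoffel G j l i y * covDeriv G X j m y
        = ∑ j, christoffel G j l i y * hessianCoord G f j k y := by
      simp only [← hG.sum_mul_covDeriv_gradCoord hf2 hy, Finset.mul_sum]
      rw [Finset.sum_comm]
      exact Finset.sum_congr rfl fun _ _ => Finset.sum_congr rfl fun _ _ => by
        simp only [hXdef]; ring
    simp only [covDeriv₂, mul_sub, Finset.sum_sub_distrib, h1, h2, N]
  have hess : ∀ l k, (1 / 2) * hessianCoord G (innerGradCoord G f f) l k y
      = ∑ i, X i y * N l k i + ∑ i, hessianCoord G f k i y * covDeriv G X l i y := by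
    intro l k
    have h1 : partialD l (partialD k (innerGradCoord G f f)) y
        = 2 * ∑ i, (partialD l (hessianCoord G f k i) y * X i y
          + hessianCoord G f k i y * partialD l (X i) y) := by
      rw [partialD_congr_on l hG.isOpen hy fun z hz => hG.partialD_innerGradCoord_self hf2 hz k,
        partialD_const_mul l _ (DifferentiableAt.fun_sum fun i _ => (hH k i).fun_mul (hXd i)),
        partialD_sum l _ fun i => (hH k i).fun_mul (hXd i)]
      congr 1
      exact Finset.sum_congr rfl fun i _ => partialD_mul l (hH k i) (hXd i)
    have h2 : ∑ m, christoffel G m l k y * partialD m (innerGradCoord G f f) y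
        = 2 * ∑ i, X i y * ∑ j, christoffel G j l k y * hessianCoord G f j i y := by
      simp only [hG.partialD_innerGradCoord_self hf2 hy, Finset.mul_sum]
      rw [Finset.sum_comm]
      exact Finset.sum_congr rfl fun _ _ => Finset.sum_congr rfl fun _ _ => by
        simp only [hXdef]; ring
    have h3 : ∑ i, X i y * ∑ j, christoffel G j l i y * hessianCoord G f k j y
        = ∑ i, hessianCoord G f k i y * ∑ j, christoffel G i l j y * X j y := by
      simp only [Finset.mul_sum]
      rw [Finset.sum_comm]
      exact Finset.sum_congr rfl fun _ _ => Finset.sum_congr rfl fun _ _ => by ring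
    rw [hessianCoord, h1, h2]
    simp only [N, mul_sub, Finset.sum_sub_distrib, h3, covDeriv, mul_add, Finset.sum_add_distrib,
      mul_comm (X _ y) (partialD _ _ _)]
    ring
  -- Swapping the last two indices of `N` makes the trace over `l, k` hit the vector index of
  -- `∇ₗ∇ᵢX`, which gives the contraction `∇ₗ∇ᵢX^l` of the Ricci identity.
  have t1 : ∑ l, ∑ k, (G y)⁻¹ l k * ∑ i, X i y * N l k i
      = ∑ i, X i y * ∑ l, covDeriv₂ G X l i l y := by
    have : ∀ l, ∑ k, (G y)⁻¹ l k * ∑ i, X i y * N l k i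
        = ∑ i, X i y * covDeriv₂ G X l i l y := by
      intro l
      simp only [Finset.mul_sum]
      rw [Finset.sum_comm]
      refine Finset.sum_congr rfl fun i _ => ?_
      rw [← hG.sum_inv_mul_mul hy (fun m => covDeriv₂ G X l i m y) l, Finset.mul_sum]
      exact Finset.sum_congr rfl fun k _ => by rw [hN l k i, hNX]; ring
    simp only [this]
    simp only [Finset.mul_sum]
    exact Finset.sum_comm
  have t2 : ∑ l, ∑ k, (G y)⁻¹ l k * ∑ i, hessianCoord G f k i y * covDeriv G X l i y
      = ∑ i, ∑ l, covDeriv G X i l y * covDeriv G X l i y := by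
    rw [Finset.sum_comm (f := fun i l => covDeriv G X i l y * covDeriv G X l i y)]
    refine Finset.sum_congr rfl fun l _ => ?_
    simp only [Finset.mul_sum]
    rw [Finset.sum_comm]
    refine Finset.sum_congr rfl fun i _ => ?_
    rw [hXdef, hG.covDeriv_gradCoord_eq hf2 hy i l, Finset.sum_mul]
    refine Finset.sum_congr rfl fun k _ => ?_
    rw [hG.hessianCoord_symm hf2 hy k i]
    ring
  have t3 : ∀ i, ∑ l, covDeriv₂ G X l i l y = partialD i (laplacianCoord G f) y
      + ∑ p, ricciCoord G p i y * X p y := by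
    intro i
    rw [hG.sum_covDeriv₂_comm hX hy i, partialD_congr_on i hG.isOpen hy
      fun z hz => hG.laplacianCoord_eq_div hf2 hz]
  have t4 : ∑ i, X i y * ∑ p, ricciCoord G p i y * X p y
      = ∑ i, ∑ j, ricciCoord G i j y * X i y * X j y := by
    simp only [Finset.mul_sum]
    rw [Finset.sum_comm]
    exact Finset.sum_congr rfl fun _ _ => Finset.sum_congr rfl fun _ _ => by ring
  have t5 : (1 / 2) * laplacianCoord G (innerGradCoord G f f) y
      = ∑ l, ∑ k, (G y)⁻¹ l k * ((1 / 2) * hessianCoord G (innerGradCoord G f f) l k y) := by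
    simp only [laplacianCoord, Finset.mul_sum]
    exact Finset.sum_congr rfl fun _ _ => Finset.sum_congr rfl fun _ _ => by ring
  rw [t5]
  simp only [hess, mul_add, Finset.sum_add_distrib, t1, t2, t3, t4]
  rw [hG.innerGradCoord_eq hy]
  ring

end Bochner

end IsMetricOn

end RiemGeom

/-! ### Invariance of the Laplacian under changes of coordinates. -/

namespace RiemGeom

section ChangeOfCoordinates

variable {n : ℕ}

theorem partialD_component {φ : EuclideanSpace ℝ (Fin n) → EuclideanSpace ℝ (Fin n)}
    {y : EuclideanSpace ℝ (Fin n)} (hφ : DifferentiableAt ℝ φ y) (i p : Fin n) :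
    partialD i (fun z => φ z p) y = fderiv ℝ φ y (EuclideanSpace.single i 1) p := by
  have := ((EuclideanSpace.proj p : EuclideanSpace ℝ (Fin n) →L[ℝ] ℝ).hasFDerivAt.comp y
    hφ.hasFDerivAt).fderiv
  simp only [partialD]
  rw [show (fun z => φ z p) = (EuclideanSpace.proj p : EuclideanSpace ℝ (Fin n) →L[ℝ] ℝ) ∘ φ
    from rfl, this]
  rfl

theorem partialD_comp_eq_sum {F : EuclideanSpace ℝ (Fin n) → ℝ}
    {φ : EuclideanSpace ℝ (Fin n) → EuclideanSpace ℝ (Fin n)} {y : EuclideanSpace ℝ (Fin n)}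
    (hF : DifferentiableAt ℝ F (φ y)) (hφ : DifferentiableAt ℝ φ y) (i : Fin n) :
    partialD i (fun z => F (φ z)) y
      = ∑ p, partialD p F (φ y) * partialD i (fun z => φ z p) y := by
  have h1 : partialD i (fun z => F (φ z)) y
      = fderiv ℝ F (φ y) (fderiv ℝ φ y (EuclideanSpace.single i 1)) := by
    simp only [partialD]
    rw [show (fun z => F (φ z)) = F ∘ φ from rfl, fderiv_comp y hF hφ]
    rfl
  rw [h1, fderiv_apply_eq_sum_partialD]
  exact Finset.sum_congr rfl fun p _ => by rw [partialD_component hφ, mul_comm]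

variable {G G' : EuclideanSpace ℝ (Fin n) → Matrix (Fin n) (Fin n) ℝ}
  {U U' : Set (EuclideanSpace ℝ (Fin n))} {y : EuclideanSpace ℝ (Fin n)}
  {φ : EuclideanSpace ℝ (Fin n) → EuclideanSpace ℝ (Fin n)}

/-- The transformation law of the lowered Christoffel symbols. -/
theorem IsMetricOn.sum_mul_christoffel_pullback (hG : IsMetricOn G U) (hG' : IsMetricOn G' U')
    (hφ : ContDiffOn ℝ 2 φ U') (hmaps : Set.MapsTo φ U' U)
    (hpull : ∀ z ∈ U', ∀ i j, G' z i j = ∑ p, ∑ q, G (φ z) p q *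
      (partialD i (fun z => φ z p) z * partialD j (fun z => φ z q) z)) (hy : y ∈ U')
    (m i j : Fin n) :
    ∑ k, G' y m k * christoffel G' k i j y = ∑ p, partialD m (fun z => φ z p) y * ∑ q, G (φ y) p q *
      (partialD i (partialD j fun z => φ z q) y + ∑ r, ∑ s, christoffel G q r s (φ y) *
        (partialD i (fun z => φ z r) y * partialD j (fun z => φ z s) y)) := by
  have hU' := hG'.isOpen.mem_nhds hy
  have hφy := hmaps hy
  have hφp : ∀ p, ContDiffOn ℝ 2 (fun z => φ z p) U' := fun p =>
    (EuclideanSpace.proj p : EuclideanSpace ℝ (Fin n) →L[ℝ] ℝ).contDiff.comp_contDiffOn hφ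
  have hφd : DifferentiableAt ℝ φ y := (hφ.contDiffAt hU').differentiableAt (by simp)
  let J : Fin n → Fin n → EuclideanSpace ℝ (Fin n) → ℝ := fun p i => partialD i fun z => φ z p
  have hJ : ∀ p i, DifferentiableAt ℝ (J p i) y := fun p i =>
    ((contDiffOn_partialD (m := 1) i hG'.isOpen (hφp p) (by norm_num)).contDiffAt
      hU').differentiableAt (by simp)
  have hGd : ∀ p q, DifferentiableAt ℝ (fun z => G z p q) (φ y) := fun p q =>
    ((hG.contDiffOn p q).contDiffAt (hG.isOpen.mem_nhds hφy)).differentiableAt (by simp)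
  have hGφ : ∀ p q, DifferentiableAt ℝ (fun z => G (φ z) p q) y := fun p q =>
    (hGd p q).comp y hφd
  let h : Fin n → Fin n → Fin n → ℝ := fun p i j => partialD i (J p j) y
  have hsymm : ∀ p i j, h p i j = h p j i := fun p i j =>
    partialD_comm i j ((hφp p).contDiffAt hU')
  let D : Fin n → Fin n → Fin n → ℝ := fun r s p => partialD r (fun z => G z s p) (φ y)
  let T : Fin n → Fin n → Fin n → ℝ := fun i j m =>
    ∑ p, ∑ r, ∑ s, D r s p * (J r i y * J s j y * J p m y)
  let A : Fin n → Fin n → Fin n → ℝ := fun i j m => ∑ p, ∑ q, G (φ y) p q * (J p m y * h q i j)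
  have hA : ∀ i j m, A i j m = A j i m := fun i j m =>
    Finset.sum_congr rfl fun p _ => Finset.sum_congr rfl fun q _ => by rw [hsymm]
  -- `T` collects the derivatives of `G`, `A` the second derivatives of `φ`. In the Koszul
  -- combination of three such identities, the symmetry of `A` in its first two indices leaves a
  -- single `A i j m`.
  have hder : ∀ i j m, partialD i (fun z => G' z j m) y = T i j m + A i j m + A i m j := by
    intro i j m
    have e : ∀ p q, partialD i (fun z => G (φ z) p q * (J p j z * J q m z)) y
        = (∑ r, D r p q * J r i y) * (J p j y * J q m y) + G (φ y) p q * (h p i j * J q m y)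
          + G (φ y) p q * (J p j y * h q i m) := by
      intro p q
      rw [partialD_mul i (hGφ p q) ((hJ p j).fun_mul (hJ q m)), partialD_mul i (hJ p j) (hJ q m),
        partialD_comp_eq_sum (F := fun z => G z p q) (hGd p q) hφd]
      ring
    rw [partialD_congr_on i hG'.isOpen hy fun z hz => hpull z hz j m,
      partialD_sum i _ fun p => DifferentiableAt.fun_sum fun q _ =>
        (hGφ p q).fun_mul ((hJ p j).fun_mul (hJ q m))]
    have e' : ∀ p, partialD i (fun z => ∑ q, G (φ z) p q * (J p j z * J q m z)) y
        = ∑ q, (∑ r, D r p q * J r i y) * (J p j y * J q m y)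
          + ∑ q, G (φ y) p q * (h p i j * J q m y) + ∑ q, G (φ y) p q * (J p j y * h q i m) := by
      intro p
      rw [partialD_sum i _ fun q => (hGφ p q).fun_mul ((hJ p j).fun_mul (hJ q m))]
      simp only [e, Finset.sum_add_distrib]
    refine (Finset.sum_congr rfl fun p _ => e' p).trans ?_
    simp only [Finset.sum_add_distrib]
    congr 1
    congr 1
    · simp only [T]
      rw [Finset.sum_comm]
      refine Finset.sum_congr rfl fun q _ => ?_
      rw [Finset.sum_comm (f := fun r s => D r s q * (J r i y * J s j y * J q m y))]
      refine Finset.sum_congr rfl fun p _ => ?_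
      rw [Finset.sum_mul]
      exact Finset.sum_congr rfl fun r _ => by ring
    · simp only [A]
      rw [Finset.sum_comm]
      exact Finset.sum_congr rfl fun p _ => Finset.sum_congr rfl fun q _ => by
        rw [hG.symm hφy q p]; ring
  have hT1 : T j i m = ∑ p, ∑ r, ∑ s, D s r p * (J r i y * J s j y * J p m y) := by
    refine Finset.sum_congr rfl fun p _ => ?_
    rw [Finset.sum_comm]
    exact Finset.sum_congr rfl fun r _ => Finset.sum_congr rfl fun s _ => by ring
  have hT2 : T m i j = ∑ p, ∑ r, ∑ s, D p r s * (J r i y * J s j y * J p m y) := by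
    simp only [T]
    rw [Finset.sum_comm]
    refine Finset.sum_congr rfl fun p _ => ?_
    rw [Finset.sum_comm]
    exact Finset.sum_congr rfl fun r _ => Finset.sum_congr rfl fun s _ => by ring
  have hR : ∀ p, ∑ q, G (φ y) p q * (h q i j + ∑ r, ∑ s, christoffel G q r s (φ y) *
        (J r i y * J s j y)) = ∑ q, G (φ y) p q * h q i j
        + ∑ r, ∑ s, (1 / 2) * (D r s p + D s r p - D p r s) * (J r i y * J s j y) := by
    intro p
    simp only [mul_add, Finset.sum_add_distrib]
    congr 1
    simp only [Finset.mul_sum]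
    rw [Finset.sum_comm]
    refine Finset.sum_congr rfl fun r _ => ?_
    rw [Finset.sum_comm]
    refine Finset.sum_congr rfl fun s _ => ?_
    rw [← hG.sum_mul_christoffel hφy p r s, Finset.sum_mul]
    exact Finset.sum_congr rfl fun q _ => by ring
  rw [hG'.sum_mul_christoffel hy, hder, hder, hder]
  refine Eq.trans ?_ (Finset.sum_congr rfl fun p _ => congrArg (J p m y * ·) (hR p).symm)
  have hlhs : (1 / 2) * (T i j m + A i j m + A i m j + (T j i m + A j i m + A j m i)
      - (T m i j + A m i j + A m j i)) = A i j m + (1 / 2) * (T i j m + T j i m - T m i j) := by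
    rw [hA j i m, hA m i j, hA m j i]
    ring
  rw [hlhs, hT1, hT2]
  simp only [T, A, mul_add, mul_sub, add_mul, sub_mul, Finset.sum_add_distrib,
    Finset.sum_sub_distrib, Finset.mul_sum]
  congr 1
  · exact Finset.sum_congr rfl fun p _ => Finset.sum_congr rfl fun q _ => by ring
  · congr 1
    · congr 1 <;>
      exact Finset.sum_congr rfl fun p _ => Finset.sum_congr rfl fun q _ =>
        Finset.sum_congr rfl fun r _ => by ring
    · exact Finset.sum_congr rfl fun p _ => Finset.sum_congr rfl fun q _ =>
        Finset.sum_congr rfl fun r _ => by ring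

/-- The Laplacian is invariant under changes of coordinates. -/
theorem IsMetricOn.laplacianCoord_comp (hG : IsMetricOn G U) (hG' : IsMetricOn G' U')
    (hφ : ContDiffOn ℝ 2 φ U') (hmaps : Set.MapsTo φ U' U)
    (hpull : ∀ z ∈ U', ∀ i j, G' z i j = ∑ p, ∑ q, G (φ z) p q *
      (partialD i (fun z => φ z p) z * partialD j (fun z => φ z q) z))
    {f f' : EuclideanSpace ℝ (Fin n) → ℝ} (hf : ContDiffOn ℝ 2 f U)
    (hff' : ∀ z ∈ U', f' z = f (φ z)) (hy : y ∈ U') :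
    laplacianCoord G' f' y = laplacianCoord G f (φ y) := by
  have hU' := hG'.isOpen.mem_nhds hy
  have hφy := hmaps hy
  have hφp : ∀ p, ContDiffOn ℝ 2 (fun z => φ z p) U' := fun p =>
    (EuclideanSpace.proj p : EuclideanSpace ℝ (Fin n) →L[ℝ] ℝ).contDiff.comp_contDiffOn hφ
  have hφd : ∀ z ∈ U', DifferentiableAt ℝ φ z := fun z hz =>
    (hφ.contDiffAt (hG'.isOpen.mem_nhds hz)).differentiableAt (by simp)
  let J : Matrix (Fin n) (Fin n) ℝ := Matrix.of fun p i => partialD i (fun z => φ z p) y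
  have hmat : G' y = J.transpose * G (φ y) * J := by
    ext i j
    rw [hpull y hy, Finset.sum_comm]
    simp only [Matrix.mul_apply, Matrix.transpose_apply, J, Matrix.of_apply, Finset.sum_mul]
    exact Finset.sum_congr rfl fun p _ => Finset.sum_congr rfl fun q _ => by ring
  -- The Jacobian is invertible because `Jᵀ G J = G'` is; no inverse of `φ` is needed.
  have hJdet : J.det ≠ 0 := by
    have := hG'.det_ne_zero hy
    rw [hmat, Matrix.det_mul] at this
    exact right_ne_zero_of_mul this
  -- The classical law for Christoffel symbols: the lowered version is this identity multiplied by
  -- the invertible matrix `Jᵀ G`.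
  have hchr : ∀ i j q, ∑ k, J q k * christoffel G' k i j y
      = partialD i (partialD j fun z => φ z q) y
        + ∑ r, ∑ s, christoffel G q r s (φ y) * (J r i * J s j) := by
    intro i j
    let w : Fin n → ℝ := fun q => ∑ k, J q k * christoffel G' k i j y
      - (partialD i (partialD j fun z => φ z q) y
        + ∑ r, ∑ s, christoffel G q r s (φ y) * (J r i * J s j))
    have hw : (J.transpose * G (φ y)).mulVec w = 0 := by
      rw [← Matrix.mulVec_mulVec]
      ext m
      have h1 := hG.sum_mul_christoffel_pullback hG' hφ hmaps hpull hy m i j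
      have h2 : ∑ k, G' y m k * christoffel G' k i j y
          = ∑ p, J p m * ∑ q, G (φ y) p q * ∑ k, J q k * christoffel G' k i j y := by
        have : (G' y).mulVec (fun k => christoffel G' k i j y) m = J.transpose.mulVec
            ((G (φ y)).mulVec (J.mulVec fun k => christoffel G' k i j y)) m := by
          rw [Matrix.mulVec_mulVec, Matrix.mulVec_mulVec, hmat]
        exact this
      have h3 : J.transpose.mulVec ((G (φ y)).mulVec w) m
          = ∑ p, J p m * ∑ q, G (φ y) p q * w q := rfl
      rw [h3]
      simp only [w, mul_sub, Finset.sum_sub_distrib]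
      rw [← h2, h1]
      exact sub_self _
    have hdet : (J.transpose * G (φ y)).det ≠ 0 := by
      rw [Matrix.det_mul, Matrix.det_transpose]
      exact mul_ne_zero hJdet (hG.det_ne_zero hφy)
    intro q
    exact sub_eq_zero.1 (congrFun (Matrix.eq_zero_of_mulVec_eq_zero hdet hw) q)
  have hfd : ∀ z ∈ U, DifferentiableAt ℝ f z := fun z hz =>
    (hf.contDiffAt (hG.isOpen.mem_nhds hz)).differentiableAt (by simp)
  have hpf : ∀ p, DifferentiableAt ℝ (partialD p f) (φ y) := fun p =>
    ((contDiffOn_partialD (m := 1) p hG.isOpen hf (by norm_num)).contDiffAt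
      (hG.isOpen.mem_nhds hφy)).differentiableAt (by simp)
  have hpφ : ∀ p j, DifferentiableAt ℝ (partialD j fun z => φ z p) y := fun p j =>
    ((contDiffOn_partialD (m := 1) j hG'.isOpen (hφp p) (by norm_num)).contDiffAt
      hU').differentiableAt (by simp)
  have hd1 : ∀ j, ∀ z ∈ U', partialD j f' z
      = ∑ p, partialD p f (φ z) * partialD j (fun z => φ z p) z := by
    intro j z hz
    rw [partialD_congr_on j hG'.isOpen hz hff', partialD_comp_eq_sum (hfd _ (hmaps hz)) (hφd z hz)]
  have hd2 : ∀ i j, partialD i (partialD j f') y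
      = ∑ p, ∑ q, partialD q (partialD p f) (φ y) * (J q i * J p j)
        + ∑ p, partialD p f (φ y) * partialD i (partialD j fun z => φ z p) y := by
    intro i j
    have hc : ∀ p, DifferentiableAt ℝ (fun z => partialD p f (φ z)) y := fun p =>
      (hpf p).comp y (hφd y hy)
    rw [partialD_congr_on i hG'.isOpen hy (hd1 j), partialD_sum i _ fun p =>
      (hc p).fun_mul (hpφ p j), ← Finset.sum_add_distrib]
    refine Finset.sum_congr rfl fun p _ => ?_
    rw [partialD_mul i (hc p) (hpφ p j), partialD_comp_eq_sum (hpf p) (hφd y hy), Finset.sum_mul]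
    congr 1
    exact Finset.sum_congr rfl fun q _ => by simp only [J, Matrix.of_apply]; ring
  -- The second derivatives of `φ` cancel against those in `hchr`, so the Hessian transforms as a
  -- tensor; its metric trace is then invariant by cyclicity.
  have hhess : ∀ i j, hessianCoord G' f' i j y
      = ∑ p, ∑ q, hessianCoord G f q p (φ y) * (J q i * J p j) := by
    intro i j
    have e1 : ∑ k, christoffel G' k i j y * partialD k f' y
        = ∑ q, partialD q f (φ y) * ∑ k, J q k * christoffel G' k i j y := by
      simp only [hd1 _ y hy, Finset.mul_sum]
      rw [Finset.sum_comm]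
      exact Finset.sum_congr rfl fun _ _ => Finset.sum_congr rfl fun _ _ => by
        simp only [J, Matrix.of_apply]; ring
    have e2 : ∑ p, partialD p f (φ y) * ∑ r, ∑ s, christoffel G p r s (φ y) * (J r i * J s j)
        = ∑ s, ∑ r, (∑ p, christoffel G p r s (φ y) * partialD p f (φ y)) * (J r i * J s j) := by
      simp only [Finset.mul_sum, Finset.sum_mul]
      rw [Finset.sum_comm]
      rw [Finset.sum_comm (s := Finset.univ (α := Fin n)) (f := fun s r =>
        ∑ p, christoffel G p r s (φ y) * partialD p f (φ y) * (J r i * J s j))]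
      refine Finset.sum_congr rfl fun r _ => ?_
      rw [Finset.sum_comm]
      exact Finset.sum_congr rfl fun _ _ => Finset.sum_congr rfl fun _ _ => by ring
    rw [hessianCoord, hd2, e1]
    simp only [hchr, mul_add, Finset.sum_add_distrib, e2, hessianCoord, sub_mul,
      Finset.sum_sub_distrib]
    ring
  have hlap : ∀ (g : Matrix (Fin n) (Fin n) ℝ) (H : Fin n → Fin n → ℝ),
      ∑ i, ∑ j, g i j * H i j = (g * (Matrix.of H).transpose).trace := by
    intro g H
    simp [Matrix.trace, Matrix.mul_apply]
  have hHmat : (Matrix.of fun i j => hessianCoord G' f' i j y).transpose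
      = J.transpose * (Matrix.of fun i j => hessianCoord G f i j (φ y)).transpose * J := by
    ext i j
    simp only [Matrix.transpose_apply, Matrix.mul_apply, Matrix.of_apply, hhess, Finset.sum_mul]
    rw [Finset.sum_comm]
    exact Finset.sum_congr rfl fun _ _ => Finset.sum_congr rfl fun _ _ => by ring
  have hJ := isUnit_iff_ne_zero.2 hJdet
  have hJt : IsUnit J.transpose.det := by rwa [Matrix.det_transpose]
  unfold laplacianCoord
  rw [hlap, hlap, hHmat, hmat, Matrix.mul_inv_rev, Matrix.mul_inv_rev]
  have : J⁻¹ * ((G (φ y))⁻¹ * J.transpose⁻¹) *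
      (J.transpose * (Matrix.of fun i j => hessianCoord G f i j (φ y)).transpose * J)
      = J⁻¹ * (((G (φ y))⁻¹ * (J.transpose⁻¹ * J.transpose) *
        (Matrix.of fun i j => hessianCoord G f i j (φ y)).transpose) * J) := by
    simp only [Matrix.mul_assoc]
  rw [this, Matrix.nonsing_inv_mul _ hJt, Matrix.mul_one, Matrix.trace_mul_comm, Matrix.mul_assoc,
    Matrix.mul_nonsing_inv _ hJ, Matrix.mul_one]

end ChangeOfCoordinates

end RiemGeom

/-! ### The trace inequality and the Bernstein inequality in coordinates. -/

namespace RiemGeom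

variable {n : ℕ}

open scoped MatrixOrder Matrix.Norms.L2Operator in
-- `H * A` need not be symmetric. Writing `A = BᵀB`, it has the same traces as the symmetric `S = B
-- H Bᵀ`, for which this is Cauchy–Schwarz on the diagonal, after adding the off-diagonal squares.
theorem trace_sq_le_mul_trace {A H : Matrix (Fin n) (Fin n) ℝ} (hA : A.PosSemidef)
    (hH : H.transpose = H) : (H * A).trace ^ 2 ≤ n * (H * A * (H * A)).trace := by
  obtain ⟨B, rfl⟩ := CStarAlgebra.nonneg_iff_eq_star_mul_self.mp hA.nonneg
  rw [Matrix.star_eq_conjTranspose, Matrix.conjTranspose_eq_transpose_of_trivial]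
  set S := B * H * B.transpose with hS
  have hSt : S.transpose = S := by
    simp [hS, Matrix.transpose_mul, hH, Matrix.mul_assoc]
  have h1 : (H * (B.transpose * B)).trace = S.trace := by
    rw [← Matrix.mul_assoc, Matrix.trace_mul_comm, ← Matrix.mul_assoc]
  have h2 : (H * (B.transpose * B) * (H * (B.transpose * B))).trace = (S * S).trace := by
    have : H * (B.transpose * B) * (H * (B.transpose * B))
        = (H * B.transpose * B * H * B.transpose) * B := by
      simp only [Matrix.mul_assoc]
    rw [this, Matrix.trace_mul_comm]
    simp only [hS, Matrix.mul_assoc]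
  rw [h1, h2]
  have h3 : (S * S).trace = ∑ i, ∑ j, S i j ^ 2 := by
    simp only [Matrix.trace, Matrix.diag, Matrix.mul_apply]
    refine Finset.sum_congr rfl fun i _ => Finset.sum_congr rfl fun j _ => ?_
    rw [sq]
    congr 1
    exact congrFun (congrFun hSt i) j
  rw [h3]
  calc S.trace ^ 2 ≤ n * ∑ i, S i i ^ 2 := by
        simpa [Matrix.trace] using
          sq_sum_le_card_mul_sum_sq (s := (Finset.univ : Finset (Fin n))) (f := fun i => S i i)
    _ ≤ n * ∑ i, ∑ j, S i j ^ 2 := by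
        gcongr with i
        exact Finset.single_le_sum (f := fun j => S i j ^ 2) (fun j _ => sq_nonneg _)
          (Finset.mem_univ i)

namespace IsMetricOn

variable {G : EuclideanSpace ℝ (Fin n) → Matrix (Fin n) (Fin n) ℝ}
  {U : Set (EuclideanSpace ℝ (Fin n))} {y : EuclideanSpace ℝ (Fin n)}
  (hG : IsMetricOn G U) {f : EuclideanSpace ℝ (Fin n) → ℝ}
include hG

/-- The mixed Hessian `T = H g⁻¹` has `tr T = Δf` and `tr T² = |∇²f|²`. -/
theorem laplacianCoord_sq_le (hf : ContDiffOn ℝ 2 f U) (hy : y ∈ U) :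
    laplacianCoord G f y ^ 2 ≤ n * ∑ i, ∑ l,
      covDeriv G (gradCoord G f) i l y * covDeriv G (gradCoord G f) l i y := by
  let H : Matrix (Fin n) (Fin n) ℝ := Matrix.of fun i j => hessianCoord G f i j y
  have hH : H.transpose = H := by
    ext i j
    exact hG.hessianCoord_symm hf hy j i
  have hT : ∀ k m, covDeriv G (gradCoord G f) k m y = (H * (G y)⁻¹) k m := by
    intro k m
    rw [hG.covDeriv_gradCoord_eq hf hy, Matrix.mul_apply]
    refine Finset.sum_congr rfl fun l _ => ?_
    rw [hG.inv_symm hy m l, mul_comm]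
    rfl
  have := trace_sq_le_mul_trace (hG.posDef y hy).inv.posSemidef hH
  rw [hG.laplacianCoord_eq_div hf hy]
  simp only [hT]
  simpa only [Matrix.trace, Matrix.diag, Matrix.mul_apply (M := H * (G y)⁻¹)] using this

theorem innerGradCoord_self_nonneg (hy : y ∈ U) : 0 ≤ innerGradCoord G f f y := by
  have := (hG.posDef y hy).inv.posSemidef.dotProduct_mulVec_nonneg (fun i => partialD i f y)
  refine this.trans_eq ?_
  simp only [innerGradCoord, dotProduct, Matrix.mulVec, Finset.mul_sum]
  exact Finset.sum_congr rfl fun _ _ => Finset.sum_congr rfl fun _ _ => by simp; ring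

theorem laplacianCoord_comp_real {ψ ψ' : ℝ → ℝ} {ψ'' : ℝ} (hf : ContDiffOn ℝ 2 f U) (hy : y ∈ U)
    (hψ : ∀ z ∈ U, HasDerivAt ψ (ψ' (f z)) (f z)) (hψ' : HasDerivAt ψ' ψ'' (f y)) :
    laplacianCoord G (fun z => ψ (f z)) y =
      ψ' (f y) * laplacianCoord G f y + ψ'' * innerGradCoord G f f y := by
  have hU := hG.isOpen.mem_nhds hy
  have hfd : ∀ z ∈ U, DifferentiableAt ℝ f z := fun z hz =>
    (hf.contDiffAt (hG.isOpen.mem_nhds hz)).differentiableAt (by simp)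
  have hpf : ∀ j, DifferentiableAt ℝ (partialD j f) y := fun j =>
    ((contDiffOn_partialD (m := 1) j hG.isOpen hf (by norm_num)).contDiffAt hU).differentiableAt
      (by simp)
  have h1 : ∀ j, ∀ z ∈ U, partialD j (fun z => ψ (f z)) z = ψ' (f z) * partialD j f z :=
    fun j z hz => partialD_comp j (hψ z hz) (hfd z hz)
  have hcd : DifferentiableAt ℝ (fun z => ψ' (f z)) y :=
    hψ'.differentiableAt.comp y (hfd y hy)
  have h2 : ∀ i j, hessianCoord G (fun z => ψ (f z)) i j y
      = ψ' (f y) * hessianCoord G f i j y + ψ'' * (partialD i f y * partialD j f y) := by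
    intro i j
    rw [hessianCoord, partialD_congr_on i hG.isOpen hy (h1 j), partialD_mul i hcd (hpf j),
      partialD_comp i hψ' (hfd y hy), hessianCoord]
    simp only [h1 _ y hy, mul_sub, Finset.mul_sum]
    rw [Finset.sum_congr rfl fun k _ => mul_left_comm (christoffel G k i j y) (ψ' (f y)) _]
    ring
  simp only [laplacianCoord, innerGradCoord, h2, Finset.mul_sum, ← Finset.sum_add_distrib]
  exact Finset.sum_congr rfl fun _ _ => Finset.sum_congr rfl fun _ _ => by ring

/-- The Bernstein-type inequality for `h = w ^ ε` in local coordinates. -/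
theorem half_laplacianCoord_innerGradCoord_ge (hn : 0 < n) {w h : EuclideanSpace ℝ (Fin n) → ℝ}
    {c α ε K C₁ : ℝ} (hε : ε ∈ Set.Ioo (0 : ℝ) 1) (hw : ContDiffOn ℝ 3 w U)
    (hpos : ∀ z ∈ U, 0 < w z) (heq : ∀ z ∈ U, laplacianCoord G w z + c * w z ^ α = 0)
    (hh : ∀ z ∈ U, h z = w z ^ ε) (hy : y ∈ U)
    (hRic : -K * innerGradCoord G h h y ≤
      ∑ i, ∑ j, ricciCoord G i j y * gradCoord G h i y * gradCoord G h j y)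
    (hquad : ∀ X : ℝ, 0 ≤ X → C₁ * X ^ 2 ≤
      (ε * (c * w y ^ (α - 1)) + (1 - ε) / ε * X) ^ 2 / n
        - (α + ε - 1) * (c * w y ^ (α - 1)) * X + (1 - ε) / ε * X ^ 2) :
    C₁ * (innerGradCoord G h h y ^ 2 / h y ^ 2)
        - (1 - ε) / ε * ((h y)⁻¹ * innerGradCoord G h (innerGradCoord G h h) y)
        - K * innerGradCoord G h h y
      ≤ (1 / 2) * laplacianCoord G (innerGradCoord G h h) y := by
  have hU := hG.isOpen.mem_nhds hy
  obtain ⟨hε0, hε1⟩ := hε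
  have hhpos : ∀ z ∈ U, 0 < h z := fun z hz => by rw [hh z hz]; exact Real.rpow_pos_of_pos (hpos z hz) _
  have hpow : ∀ s : ℝ, ContDiffOn ℝ 3 (fun z => w z ^ s) U := fun s =>
    hw.rpow_const_of_ne fun z hz => (hpos z hz).ne'
  have hhC : ContDiffOn ℝ 3 h U := (hpow ε).congr hh
  set P := innerGradCoord G h h with hP
  have hPC : ContDiffOn ℝ 2 P U :=
    hG.contDiffOn_innerGradCoord hhC hhC (by norm_num) (WithTop.coe_le_coe.2 le_top)
  have hwd : ∀ z ∈ U, DifferentiableAt ℝ w z := fun z hz =>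
    (hw.contDiffAt (hG.isOpen.mem_nhds hz)).differentiableAt (by simp)
  have hder : ∀ s : ℝ, ∀ z ∈ U, HasDerivAt (fun t : ℝ => t ^ s) (s * w z ^ (s - 1)) (w z) :=
    fun s z hz => Real.hasDerivAt_rpow_const (Or.inl (hpos z hz).ne')
  have hdpow : ∀ s : ℝ, ∀ i, ∀ z ∈ U,
      partialD i (fun z => w z ^ s) z = s * w z ^ (s - 1) * partialD i w z :=
    fun s i z hz => partialD_comp i (hder s z hz) (hwd z hz)
  have hdh : ∀ i, ∀ z ∈ U, partialD i h z = ε * w z ^ (ε - 1) * partialD i w z := by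
    intro i z hz
    rw [partialD_congr_on i hG.isOpen hz hh, hdpow ε i z hz]
  have hPw : ∀ z ∈ U, P z = (ε * w z ^ (ε - 1)) ^ 2 * innerGradCoord G w w z := by
    intro z hz
    simp only [hP, innerGradCoord, hdh _ z hz, Finset.mul_sum]
    exact Finset.sum_congr rfl fun _ _ => Finset.sum_congr rfl fun _ _ => by ring
  have hlap : ∀ z ∈ U, laplacianCoord G h z
      = -(c * ε) * (w z ^ (α - 1) * h z) - (1 - ε) / ε * (P z * (h z)⁻¹) := by
    intro z hz
    have hz0 := hpos z hz
    have e0 : laplacianCoord G h z = laplacianCoord G (fun z => w z ^ ε) z := by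
      unfold laplacianCoord hessianCoord
      have : ∀ k, ∀ z ∈ U, partialD k h z = partialD k (fun z => w z ^ ε) z :=
        fun k z hz => partialD_congr_on k hG.isOpen hz hh
      simp only [this _ z hz, fun i j => partialD_congr_on i hG.isOpen hz (this j)]
    have e1 := hG.laplacianCoord_comp_real (hw.of_le (by norm_num)) hz
      (ψ := fun t => t ^ ε) (ψ' := fun t => ε * t ^ (ε - 1)) (hder ε)
      ((hder (ε - 1) z hz).const_mul ε)
    rw [e0, e1, eq_neg_of_add_eq_zero_left (heq z hz), hPw z hz, hh z hz]
    have p1 : w z ^ (α - 1) = w z ^ α / w z := Real.rpow_sub_one hz0.ne' _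
    have p2 : w z ^ (ε - 1) = w z ^ ε / w z := Real.rpow_sub_one hz0.ne' _
    have p3 : w z ^ (ε - 1 - 1) = w z ^ ε / w z / w z := by
      rw [Real.rpow_sub_one hz0.ne', p2]
    rw [p1, p2, p3]
    have : w z ^ ε ≠ 0 := (Real.rpow_pos_of_pos hz0 _).ne'
    field_simp
    ring
  have hqd : DifferentiableAt ℝ (fun z => w z ^ (α - 1)) y :=
    ((hpow _).contDiffAt hU).differentiableAt (by simp)
  have hhd : DifferentiableAt ℝ h y := (hhC.contDiffAt hU).differentiableAt (by simp)
  have hPd : DifferentiableAt ℝ P y := (hPC.contDiffAt hU).differentiableAt (by simp)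
  have hid : DifferentiableAt ℝ (fun z => (h z)⁻¹) y := hhd.inv (hhpos y hy).ne'
  have hdlap : ∀ i, partialD i (laplacianCoord G h) y
      = (-c * (α + ε - 1) * w y ^ (α - 1) + (1 - ε) / ε * (P y / h y ^ 2)) * partialD i h y
        - (1 - ε) / ε * (h y)⁻¹ * partialD i P y := by
    intro i
    have hdi : partialD i (fun z => (h z)⁻¹) y = -(h y ^ 2)⁻¹ * partialD i h y :=
      partialD_comp i (hasDerivAt_inv (hhpos y hy).ne') hhd
    -- Both `w ^ (α - 1)` and `h` are powers of `w`, so their logarithmic derivatives are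
    -- proportional; this eliminates `∂w` in favour of `∂h`.
    have hdq : ε * partialD i (fun z => w z ^ (α - 1)) y * h y
        = (α - 1) * w y ^ (α - 1) * partialD i h y := by
      rw [hdpow _ i y hy, hdh i y hy, hh y hy, Real.rpow_sub_one (hpos y hy).ne' (α - 1),
        Real.rpow_sub_one (hpos y hy).ne' ε]
      ring
    rw [partialD_congr_on i hG.isOpen hy hlap,
      partialD_sub i ((hqd.fun_mul hhd).const_mul _) ((hPd.fun_mul hid).const_mul _),
      partialD_const_mul i _ (hqd.fun_mul hhd), partialD_const_mul i _ (hPd.fun_mul hid),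
      partialD_mul i hqd hhd, partialD_mul i hPd hid, hdi]
    linear_combination (-c) * hdq
  have hin : innerGradCoord G h (laplacianCoord G h) y
      = (-c * (α + ε - 1) * w y ^ (α - 1) + (1 - ε) / ε * (P y / h y ^ 2)) * P y
        - (1 - ε) / ε * (h y)⁻¹ * innerGradCoord G h P y := by
    have hPy : P y = ∑ i, gradCoord G h i y * partialD i h y := hG.innerGradCoord_eq hy h
    rw [hG.innerGradCoord_eq hy, hG.innerGradCoord_eq hy P]
    nth_rw 2 [hPy]
    simp only [hdlap, Finset.mul_sum, ← Finset.sum_sub_distrib]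
    exact Finset.sum_congr rfl fun i _ => by ring
  have hboch := hG.bochner hhC hy
  have hcs := hG.laplacianCoord_sq_le (hhC.of_le (by norm_num)) hy
  rw [← hP] at hboch
  rw [hboch, hin]
  have hn' : (0 : ℝ) < n := by exact_mod_cast hn
  rw [mul_comm, ← div_le_iff₀ hn', hlap y hy] at hcs
  have hy0 := hhpos y hy
  have hP0 : 0 ≤ P y := hG.innerGradCoord_self_nonneg hy
  -- The algebraic inequality at `X = |∇h|² / h²`, multiplied by `h²` to match the terms of
  -- Bochner's formula.
  have hq := mul_le_mul_of_nonneg_right (hquad (P y / h y ^ 2) (by positivity)) (sq_nonneg (h y))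
  set q := w y ^ (α - 1)
  set a := (1 - ε) / ε
  have i1 : C₁ * (P y / h y ^ 2) ^ 2 * h y ^ 2 = C₁ * (P y ^ 2 / h y ^ 2) := by
    field_simp
  have i2 : ((ε * (c * q) + a * (P y / h y ^ 2)) ^ 2 / n - (α + ε - 1) * (c * q) * (P y / h y ^ 2)
      + a * (P y / h y ^ 2) ^ 2) * h y ^ 2
      = (-(c * ε) * (q * h y) - a * (P y * (h y)⁻¹)) ^ 2 / n
        + (-c * (α + ε - 1) * q + a * (P y / h y ^ 2)) * P y := by
    field_simp
    ring
  rw [i1, i2] at hq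
  linarith

end IsMetricOn

end RiemGeom

/-! ### From the manifold to charts. -/

namespace RiemGeom

/-- The inverse Gram matrix recovers the coefficients of `a` from its inner products with the basis.
With `inner_grad` this yields the formula `g^{ij} ∂ᵢf ∂ⱼh`. -/
theorem inner_eq_sum_gram_inv {V : Type*} [NormedAddCommGroup V] [InnerProductSpace ℝ V] {n : ℕ}
    {e : Fin n → V} (hli : LinearIndependent ℝ e) (hsp : ⊤ ≤ Submodule.span ℝ (Set.range e))
    (a b : V) : inner ℝ a b
      = ∑ i, ∑ j, (Matrix.gram ℝ e)⁻¹ i j * inner ℝ a (e i) * inner ℝ b (e j) := by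
  set g := Matrix.gram ℝ e with hg
  let B := Module.Basis.mk hli hsp
  have ha : a = ∑ i, B.repr a i • e i := by
    conv_lhs => rw [← B.sum_repr a]
    simp [B]
  have hdet : IsUnit g.det :=
    isUnit_iff_ne_zero.2 (Matrix.posDef_gram_of_linearIndependent hli).det_pos.ne'
  have hc : (fun i => inner ℝ a (e i)) = Matrix.vecMul (fun i => B.repr a i) g := by
    ext i
    conv_lhs => rw [ha]
    simp [sum_inner, inner_smul_left, Matrix.vecMul, dotProduct, hg]
  have hc' : Matrix.vecMul (fun i => inner ℝ a (e i)) g⁻¹ = fun i => B.repr a i := by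
    rw [hc, Matrix.vecMul_vecMul, Matrix.mul_nonsing_inv _ hdet, Matrix.vecMul_one]
  have hj : ∀ j, ∑ i, g⁻¹ i j * inner ℝ a (e i) = B.repr a j := fun j => by
    rw [← congrFun hc' j]
    exact Finset.sum_congr rfl fun i _ => mul_comm _ _
  rw [Finset.sum_comm]
  simp only [← Finset.sum_mul, hj]
  conv_lhs => rw [ha, sum_inner]
  exact Finset.sum_congr rfl fun i _ => by rw [inner_smul_left, real_inner_comm b]; rfl

theorem top_le_span_range_of_surjective {V W : Type*} [AddCommGroup V] [Module ℝ V] [AddCommGroup W]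
    [Module ℝ W] {ι : Type*} {D : V →ₗ[ℝ] W} (hD : Function.Surjective D)
    (b : Module.Basis ι ℝ V) : ⊤ ≤ Submodule.span ℝ (Set.range fun i => D (b i)) := by
  rw [← LinearMap.range_eq_top.2 hD, LinearMap.range_eq_map, ← b.span_eq, Submodule.map_span,
    ← Set.range_comp]
  rfl

section Charts

variable {n : ℕ} {M : Type*} [TopologicalSpace M] [ChartedSpace (EuclideanSpace ℝ (Fin n)) M]

theorem coordVector_eq (x : M) (y : EuclideanSpace ℝ (Fin n)) :
    coordVector n x y = fun i => (mfderiv (𝓡 n) (𝓡 n) (extChartAt (𝓡 n) x).symm y).toLinearMap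
      ((EuclideanSpace.basisFun (Fin n) ℝ).toBasis i) := by
  ext1 i
  simp only [OrthonormalBasis.coe_toBasis, EuclideanSpace.basisFun_apply]
  rfl

theorem isOpen_target_inter_preimage {Ω : Set M} (hΩ : IsOpen Ω) (x : M) :
    IsOpen ((extChartAt (𝓡 n) x).target ∩ (extChartAt (𝓡 n) x).symm ⁻¹' Ω) :=
  (continuousOn_extChartAt_symm x).isOpen_inter_preimage (isOpen_extChartAt_target x) hΩ

section Metric

variable [RiemannianBundle (fun x : M => TangentSpace (𝓡 n) x)]

/-- The metric at a point as a bilinear form on the model space. -/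
noncomputable def metricAt (p : M) :
    EuclideanSpace ℝ (Fin n) →ₗ[ℝ] EuclideanSpace ℝ (Fin n) →ₗ[ℝ] ℝ :=
  innerₗ (TangentSpace (𝓡 n) p)

theorem chartMetric_eq_gram (x : M) (y : EuclideanSpace ℝ (Fin n)) :
    chartMetric n x y = Matrix.gram ℝ (coordVector n x y) := rfl

end Metric

variable [IsManifold (𝓡 n) ∞ M]

theorem isManifold_one : IsManifold (𝓡 n) 1 M := IsManifold.of_le (n := ∞) (by simp)

theorem mdifferentiableAt_extChartAt_symm {x : M} {y : EuclideanSpace ℝ (Fin n)}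
    (hy : y ∈ (extChartAt (𝓡 n) x).target) :
    MDifferentiableAt (𝓡 n) (𝓡 n) (extChartAt (𝓡 n) x).symm y :=
  ((contMDiffOn_extChartAt_symm (n := ∞) x).contMDiffAt
    ((isOpen_extChartAt_target x).mem_nhds hy)).mdifferentiableAt (by simp)

theorem bijective_mfderiv_extChartAt_symm {x : M} {y : EuclideanSpace ℝ (Fin n)}
    (hy : y ∈ (extChartAt (𝓡 n) x).target) :
    Function.Bijective (mfderiv (𝓡 n) (𝓡 n) (extChartAt (𝓡 n) x).symm y) := by
  have := isManifold_one (n := n) (M := M)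
  have h := isInvertible_mfderivWithin_extChartAt_symm (I := 𝓡 n) hy
  rw [ModelWithCorners.Boundaryless.range_eq_univ, mfderivWithin_univ] at h
  exact h.bijective

theorem linearIndependent_coordVector {x : M} {y : EuclideanSpace ℝ (Fin n)}
    (hy : y ∈ (extChartAt (𝓡 n) x).target) : LinearIndependent ℝ (coordVector n x y) := by
  rw [coordVector_eq]
  exact (EuclideanSpace.basisFun (Fin n) ℝ).toBasis.linearIndependent.map' _
    (LinearMap.ker_eq_bot.2 (bijective_mfderiv_extChartAt_symm hy).1)

theorem span_coordVector {x : M} {y : EuclideanSpace ℝ (Fin n)}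
    (hy : y ∈ (extChartAt (𝓡 n) x).target) :
    ⊤ ≤ Submodule.span ℝ (Set.range (coordVector n x y)) := by
  rw [coordVector_eq]
  exact top_le_span_range_of_surjective (bijective_mfderiv_extChartAt_symm hy).2 _

/-- Coordinate vector fields differentiate functions by partial derivatives. -/
theorem mfderiv_coordVector {x : M} {y : EuclideanSpace ℝ (Fin n)}
    (hy : y ∈ (extChartAt (𝓡 n) x).target) {F : M → ℝ}
    (hF : MDifferentiableAt (𝓡 n) 𝓘(ℝ, ℝ) F ((extChartAt (𝓡 n) x).symm y)) (i : Fin n) :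
    mfderiv (𝓡 n) 𝓘(ℝ, ℝ) F ((extChartAt (𝓡 n) x).symm y) (coordVector n x y i)
      = partialD i (F ∘ (extChartAt (𝓡 n) x).symm) y := by
  unfold partialD
  rw [← mfderiv_eq_fderiv, mfderiv_comp y hF (mdifferentiableAt_extChartAt_symm hy)]
  rfl

theorem contDiffOn_comp_extChartAt_symm {k : ℕ∞ω} (hk : k ≤ ∞) {Ω : Set M} {F : M → ℝ}
    (hF : ContMDiffOn (𝓡 n) 𝓘(ℝ, ℝ) k F Ω) (x : M) :
    ContDiffOn ℝ k (F ∘ (extChartAt (𝓡 n) x).symm)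
      ((extChartAt (𝓡 n) x).target ∩ (extChartAt (𝓡 n) x).symm ⁻¹' Ω) := by
  rw [← contMDiffOn_iff_contDiffOn]
  exact hF.comp' ((contMDiffOn_extChartAt_symm (n := ∞) x).of_le hk)

variable [RiemannianBundle (fun x : M => TangentSpace (𝓡 n) x)]

/-- Inner products of gradients, computed in a chart. -/
theorem inner_grad_grad {x : M} {y : EuclideanSpace ℝ (Fin n)}
    (hy : y ∈ (extChartAt (𝓡 n) x).target) {F H : M → ℝ}
    (hF : MDifferentiableAt (𝓡 n) 𝓘(ℝ, ℝ) F ((extChartAt (𝓡 n) x).symm y))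
    (hH : MDifferentiableAt (𝓡 n) 𝓘(ℝ, ℝ) H ((extChartAt (𝓡 n) x).symm y)) :
    inner ℝ (grad n F ((extChartAt (𝓡 n) x).symm y)) (grad n H ((extChartAt (𝓡 n) x).symm y))
      = innerGradCoord (chartMetric n x) (F ∘ (extChartAt (𝓡 n) x).symm)
          (H ∘ (extChartAt (𝓡 n) x).symm) y := by
  rw [inner_eq_sum_gram_inv (V := TangentSpace (𝓡 n) ((extChartAt (𝓡 n) x).symm y))
    (linearIndependent_coordVector hy) (span_coordVector hy)]
  simp only [inner_grad, mfderiv_coordVector hy hF, mfderiv_coordVector hy hH]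
  rfl

theorem isMetricOn_chartMetric [IsContMDiffRiemannianBundle (𝓡 n) ∞ (EuclideanSpace ℝ (Fin n))
    (fun x : M => TangentSpace (𝓡 n) x)] (x : M) :
    IsMetricOn (chartMetric n x) (extChartAt (𝓡 n) x).target where
  isOpen := isOpen_extChartAt_target x
  contDiffOn i j := by
    have := isManifold_one (n := n) (M := M)
    have hopen := isOpen_extChartAt_target (I := 𝓡 n) x
    -- Each coordinate field is the tangent map of the inverse chart applied to a constant field,
    -- hence smooth; smoothness of the bundle metric then gives smooth coefficients.
    have hc : ∀ i, ContMDiffOn (𝓡 n) ((𝓡 n).prod 𝓘(ℝ, EuclideanSpace ℝ (Fin n))) ∞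
        (fun y => (⟨(extChartAt (𝓡 n) x).symm y, coordVector n x y i⟩ :
          TotalSpace (EuclideanSpace ℝ (Fin n)) fun x : M => TangentSpace (𝓡 n) x))
        (extChartAt (𝓡 n) x).target := by
      intro i
      have h1 := (contMDiffOn_extChartAt_symm (I := 𝓡 n) (n := ∞) x).contMDiffOn_tangentMapWithin
        (m := ∞) (by simp) hopen.uniqueMDiffOn
      have h2 : ContMDiffOn 𝓘(ℝ, EuclideanSpace ℝ (Fin n)) 𝓘(ℝ, EuclideanSpace ℝ (Fin n)).tangent ∞
          (fun y => (⟨y, (EuclideanSpace.single i 1 : EuclideanSpace ℝ (Fin n))⟩ :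
            TangentBundle 𝓘(ℝ, EuclideanSpace ℝ (Fin n)) (EuclideanSpace ℝ (Fin n))))
          (extChartAt (𝓡 n) x).target :=
        contMDiffOn_vectorSpace_iff_contDiffOn.2 contDiffOn_const
      refine (h1.comp h2 fun y hy => hy).congr fun y hy => ?_
      simp only [Function.comp, tangentMapWithin, mfderivWithin_of_isOpen hopen hy]
      rfl
    exact contMDiffOn_iff_contDiffOn.1 ((hc i).inner_bundle (hc j))
  posDef y hy := by
    rw [chartMetric_eq_gram]
    exact Matrix.posDef_gram_of_linearIndependent (linearIndependent_coordVector hy)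

/-- The transformation law of the metric coefficients. -/
theorem chartMetric_transition {x z : M} {y : EuclideanSpace ℝ (Fin n)}
    (hy : y ∈ (extChartAt (𝓡 n) z).target ∩
      (extChartAt (𝓡 n) z).symm ⁻¹' (extChartAt (𝓡 n) x).source) (i j : Fin n) :
    chartMetric n z y i j = ∑ p, ∑ q,
      chartMetric n x (extChartAt (𝓡 n) x ((extChartAt (𝓡 n) z).symm y)) p q *
        (partialD i (fun y => extChartAt (𝓡 n) x ((extChartAt (𝓡 n) z).symm y) p) y *
          partialD j (fun y => extChartAt (𝓡 n) x ((extChartAt (𝓡 n) z).symm y) q) y) := by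
  have := isManifold_one (n := n) (M := M)
  obtain ⟨hyz, hyx⟩ := hy
  set φ : EuclideanSpace ℝ (Fin n) → EuclideanSpace ℝ (Fin n) :=
    extChartAt (𝓡 n) x ∘ (extChartAt (𝓡 n) z).symm with hφ
  have hφy : φ y ∈ (extChartAt (𝓡 n) x).target := (extChartAt (𝓡 n) x).map_source hyx
  have hφm : MDifferentiableAt (𝓡 n) (𝓡 n) φ y :=
    (mdifferentiableAt_extChartAt (by simpa using hyx)).comp y (mdifferentiableAt_extChartAt_symm hyz)
  have hφd : DifferentiableAt ℝ φ y := mdifferentiableAt_iff_differentiableAt.1 hφm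
  have hopen := isOpen_target_inter_preimage (n := n) (isOpen_extChartAt_source (I := 𝓡 n) x) z
  have hcongr : (extChartAt (𝓡 n) z).symm =ᶠ[nhds y] (extChartAt (𝓡 n) x).symm ∘ φ :=
    Filter.eventuallyEq_of_mem (hopen.mem_nhds ⟨hyz, hyx⟩) fun w hw =>
      ((extChartAt (𝓡 n) x).left_inv hw.2).symm
  have hpt : (extChartAt (𝓡 n) z).symm y = (extChartAt (𝓡 n) x).symm (φ y) := hcongr.self_of_nhds
  let D : EuclideanSpace ℝ (Fin n) →L[ℝ] EuclideanSpace ℝ (Fin n) :=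
    mfderiv (𝓡 n) (𝓡 n) (extChartAt (𝓡 n) x).symm (φ y)
  -- The coordinate vectors are retyped in the model space, so that the base point inside `metricAt`
  -- can be rewritten by `hpt` without disturbing their types.
  obtain ⟨a, ha⟩ : ∃ a : Fin n → EuclideanSpace ℝ (Fin n), a = coordVector n z y := ⟨_, rfl⟩
  have hder : ∀ i, a i = ∑ p, partialD i (fun y => φ y p) y •
        D (EuclideanSpace.single p 1) := by
    intro i
    have h1 : a i = D (fderiv ℝ φ y (EuclideanSpace.single i 1)) := by
      have := hcongr.mfderiv_eq (I := 𝓡 n) (I' := 𝓡 n)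
      rw [mfderiv_comp y (mdifferentiableAt_extChartAt_symm hφy) hφm, mfderiv_eq_fderiv] at this
      rw [ha]
      exact congrArg (fun L : EuclideanSpace ℝ (Fin n) →L[ℝ] EuclideanSpace ℝ (Fin n) =>
        L (EuclideanSpace.single i 1)) this
    have h2 : ∀ v : EuclideanSpace ℝ (Fin n), v = ∑ p, v p • EuclideanSpace.single p (1 : ℝ) := by
      intro v
      conv_lhs => rw [← (EuclideanSpace.basisFun (Fin n) ℝ).sum_repr v]
      simp
    rw [h1, h2 (fderiv ℝ φ y (EuclideanSpace.single i 1)), map_sum]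
    refine Finset.sum_congr rfl fun p _ => ?_
    rw [map_smul, partialD_component hφd]
  have h0 : chartMetric n z y i j = metricAt ((extChartAt (𝓡 n) z).symm y) (a i) (a j) := by
    rw [ha]
    rfl
  conv_lhs => rw [h0, hpt, hder, hder]
  simp only [map_sum, map_smul, LinearMap.sum_apply, LinearMap.smul_apply, smul_eq_mul,
    Finset.mul_sum]
  rw [Finset.sum_comm]
  refine Finset.sum_congr rfl fun p _ => Finset.sum_congr rfl fun q _ => ?_
  change _ = metricAt ((extChartAt (𝓡 n) x).symm (φ y)) (D (EuclideanSpace.single p 1))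
    (D (EuclideanSpace.single q 1)) *
      (partialD i (fun y => φ y p) y * partialD j (fun y => φ y q) y)
  ring

variable [IsContMDiffRiemannianBundle (𝓡 n) ∞ (EuclideanSpace ℝ (Fin n))
  (fun x : M => TangentSpace (𝓡 n) x)]

/-- The Laplacian can be computed in any chart. -/
theorem laplacian_eq_laplacianCoord {Ω : Set M} (hΩ : IsOpen Ω) {F : M → ℝ}
    (hF : ContMDiffOn (𝓡 n) 𝓘(ℝ, ℝ) 2 F Ω) {x : M} {y : EuclideanSpace ℝ (Fin n)}
    (hy : y ∈ (extChartAt (𝓡 n) x).target ∩ (extChartAt (𝓡 n) x).symm ⁻¹' Ω) :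
    laplacian n F ((extChartAt (𝓡 n) x).symm y)
      = laplacianCoord (chartMetric n x) (F ∘ (extChartAt (𝓡 n) x).symm) y := by
  set z := (extChartAt (𝓡 n) x).symm y with hz
  have hzx : z ∈ (extChartAt (𝓡 n) x).source := (extChartAt (𝓡 n) x).map_target hy.1
  have hyz : extChartAt (𝓡 n) x z = y := (extChartAt (𝓡 n) x).right_inv hy.1
  have hU := isOpen_target_inter_preimage (n := n) hΩ x
  have hΩ' := hΩ.inter (isOpen_extChartAt_source (I := 𝓡 n) x)
  have hU' := isOpen_target_inter_preimage (n := n) hΩ' z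
  have hzz : (extChartAt (𝓡 n) z).symm (extChartAt (𝓡 n) z z) = z := extChartAt_to_inv z
  have hmem : extChartAt (𝓡 n) z z ∈ (extChartAt (𝓡 n) z).target ∩
      (extChartAt (𝓡 n) z).symm ⁻¹' (Ω ∩ (extChartAt (𝓡 n) x).source) := by
    refine ⟨mem_extChartAt_target z, ?_⟩
    rw [Set.mem_preimage, hzz]
    exact ⟨hy.2, hzx⟩
  have hφ : ContDiffOn ℝ 2 (fun w => extChartAt (𝓡 n) x ((extChartAt (𝓡 n) z).symm w))
      ((extChartAt (𝓡 n) z).target ∩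
        (extChartAt (𝓡 n) z).symm ⁻¹' (Ω ∩ (extChartAt (𝓡 n) x).source)) := by
    rw [← contMDiffOn_iff_contDiffOn]
    have h1 : ContMDiffOn (𝓡 n) (𝓡 n) ∞ (extChartAt (𝓡 n) x) (chartAt _ x).source :=
      contMDiffOn_extChartAt
    refine ((h1.comp (contMDiffOn_extChartAt_symm (n := ∞) z |>.mono Set.inter_subset_left)
      fun w hw => ?_).of_le (WithTop.coe_le_coe.2 le_top))
    simpa using hw.2.2
  have := ((isMetricOn_chartMetric x).mono hU Set.inter_subset_left).laplacianCoord_comp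
    ((isMetricOn_chartMetric z).mono hU' Set.inter_subset_left) hφ
    (fun w hw => ⟨(extChartAt (𝓡 n) x).map_source hw.2.2, by
      rw [Set.mem_preimage, (extChartAt (𝓡 n) x).left_inv hw.2.2]
      exact hw.2.1⟩)
    (fun w hw i j => chartMetric_transition ⟨hw.1, hw.2.2⟩ i j)
    (contDiffOn_comp_extChartAt_symm (WithTop.coe_le_coe.2 le_top) hF x)
    (f' := F ∘ (extChartAt (𝓡 n) z).symm)
    (fun w hw => by
      simp only [Function.comp]
      rw [(extChartAt (𝓡 n) x).left_inv hw.2.2]) hmem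
  rw [laplacian, this, hzz, hyz]

/-- The `i`-th component of `v` is `dκ(v) = ⟨∇κ, v⟩` for the coordinate function `κ`, whose partial
derivatives are `δᵢⱼ`. -/
theorem tangentCoord_grad {x : M} {F : M → ℝ} (hF : MDifferentiableAt (𝓡 n) 𝓘(ℝ, ℝ) F x)
    (i : Fin n) : tangentCoord x (grad n F x) i = gradCoord (chartMetric n x)
      (F ∘ (extChartAt (𝓡 n) x).symm) i (extChartAt (𝓡 n) x x) := by
  have := isManifold_one (n := n) (M := M)
  have hG := isMetricOn_chartMetric (n := n) x
  have hy := mem_extChartAt_target (I := 𝓡 n) x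
  have hxx : (extChartAt (𝓡 n) x).symm (extChartAt (𝓡 n) x x) = x := extChartAt_to_inv x
  let ℓ : EuclideanSpace ℝ (Fin n) →L[ℝ] ℝ := EuclideanSpace.proj i
  let κ : M → ℝ := ℓ ∘ extChartAt (𝓡 n) x
  have hℓ : MDifferentiableAt (𝓡 n) 𝓘(ℝ, ℝ) ℓ (extChartAt (𝓡 n) x x) :=
    ℓ.differentiableAt.mdifferentiableAt
  have he : MDifferentiableAt (𝓡 n) (𝓡 n) (extChartAt (𝓡 n) x) x :=
    mdifferentiableAt_extChartAt (mem_chart_source _ x)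
  have hκ : MDifferentiableAt (𝓡 n) 𝓘(ℝ, ℝ) κ x := hℓ.comp x he
  have h1 : ∀ v : TangentSpace (𝓡 n) x,
      tangentCoord x v i = mfderiv (𝓡 n) 𝓘(ℝ, ℝ) κ x v := by
    intro v
    rw [show κ = ℓ ∘ extChartAt (𝓡 n) x from rfl, mfderiv_comp x hℓ he, mfderiv_eq_fderiv, ℓ.fderiv]
    rfl
  -- The inverse chart returns to `x` only up to a propositional equality, while the tangent space
  -- depends on the point; generalizing the point lets the equality be eliminated.
  have h2 : ∀ p, p = x → inner ℝ (grad n F p) (grad n κ p) = inner ℝ (grad n F x) (grad n κ x) := by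
    rintro _ rfl
    rfl
  have hin := inner_grad_grad hy (F := F) (H := κ) (by rwa [hxx]) (by rwa [hxx])
  have hκp : ∀ j, partialD j (κ ∘ (extChartAt (𝓡 n) x).symm) (extChartAt (𝓡 n) x x)
      = if j = i then 1 else 0 := by
    intro j
    rw [partialD_congr_on j (isOpen_extChartAt_target x) hy (g := ℓ) fun z hz => by
      simp only [κ, Function.comp]
      rw [(extChartAt (𝓡 n) x).right_inv hz]]
    rw [partialD, ℓ.fderiv]
    simp [ℓ, eq_comm]
  rw [h1, ← inner_grad, real_inner_comm, ← h2 _ hxx, hin, hG.innerGradCoord_eq hy]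
  simp only [hκp, mul_ite, mul_one, mul_zero, Finset.sum_ite_eq', Finset.mem_univ, if_true]

end Charts

end RiemGeom

/-! ### The choice of the exponent. -/

namespace RiemGeom

theorem exists_exponent {n : ℕ} (hn : 0 < n) (α : ℝ) : ∃ ε ∈ Set.Ioo (0 : ℝ) 1,
    ∀ c q X : ℝ, 0 < q → 0 ≤ X → ((c < 0 ∧ 0 < α) ∨
      (0 < c ∧ 3 ≤ n ∧ ((n : ℝ) + 2) / (2 * ((n : ℝ) - 1)) < α ∧
        α < (2 * (n : ℝ) ^ 2 + 9 * (n : ℝ) + 6) / (2 * (n : ℝ) * ((n : ℝ) + 2)))) →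
    (1 - ε) / ε * X ^ 2 ≤ (ε * (c * q) + (1 - ε) / ε * X) ^ 2 / n
        - (α + ε - 1) * (c * q) * X + (1 - ε) / ε * X ^ 2 := by
  have hn0 : (0 : ℝ) < n := by exact_mod_cast hn
  by_cases h0 : 0 < α
  swap
  -- For `α ≤ 0` neither case can occur: in the second, `n ≥ 3` makes the lower bound for `α`
  -- positive.
  · refine ⟨1 / 2, by norm_num, fun c q X _ _ h => absurd ?_ h0⟩
    rcases h with h | ⟨-, h3, h, -⟩
    · exact h.2
    · have h3' : (3 : ℝ) ≤ n := by exact_mod_cast h3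
      exact lt_trans (div_pos (by linarith) (by linarith)) h
  by_cases h4 : α * n < n + 4
  · have hlt : α * n / (n + 4) < 1 := by rw [div_lt_one (by positivity)]; exact h4
    have hgt : 0 < α * n / (n + 4) := by positivity
    refine ⟨1 - α * n / (n + 4), ⟨by linarith, by linarith⟩, fun c q X _ _ _ => ?_⟩
    set ε := 1 - α * n / (n + 4) with hε
    have hε0 : 0 < ε := by rw [hε]; linarith
    -- The relation defining `ε`: the square has cross term `2 (1 - ε) c q X / n`, and subtracting
    -- twice that amount reverses its sign.
    have h1 : (α + ε - 1) * n = 4 * (1 - ε) := by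
      rw [hε]
      field_simp
      ring
    have h2 : (ε * (c * q) + (1 - ε) / ε * X) ^ 2 / n - (α + ε - 1) * (c * q) * X
        = (ε * (c * q) - (1 - ε) / ε * X) ^ 2 / n := by
      field_simp
      linear_combination (-(c * q * X * ε ^ 2)) * h1
    rw [h2]
    have : 0 ≤ (ε * (c * q) - (1 - ε) / ε * X) ^ 2 / n := by positivity
    linarith
  · push Not at h4
    refine ⟨1 / 2, by norm_num, fun c q X hq hX h => ?_⟩
    rcases h with ⟨hc, -⟩ | ⟨-, -, -, h⟩
    · have hα : 1 ≤ α := by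
        by_contra hα
        push Not at hα
        nlinarith
      have h1 : 0 ≤ (1 / 2 * (c * q) + (1 - 1 / 2) / (1 / 2) * X) ^ 2 / n := by positivity
      have h2 : 0 ≤ (α + 1 / 2 - 1) * (-c * q) * X :=
        mul_nonneg (mul_nonneg (by linarith) (mul_nonneg (by linarith) hq.le)) hX
      linarith
    -- The upper bound of the second case lies below `(n + 4) / n`, because `2n² + 9n + 6 < 2 (n +
    -- 2)(n + 4)`.
    · exfalso
      rw [lt_div_iff₀ (by positivity)] at h
      nlinarith

/-! ### The inequality on the manifold. -/

section Manifold

variable {n : ℕ} {M : Type*} [TopologicalSpace M] [ChartedSpace (EuclideanSpace ℝ (Fin n)) M]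

theorem laplacianCoord_congr_on {G : EuclideanSpace ℝ (Fin n) → Matrix (Fin n) (Fin n) ℝ}
    {U : Set (EuclideanSpace ℝ (Fin n))} (hU : IsOpen U) {y : EuclideanSpace ℝ (Fin n)} (hy : y ∈ U)
    {f g : EuclideanSpace ℝ (Fin n) → ℝ} (h : ∀ z ∈ U, f z = g z) :
    laplacianCoord G f y = laplacianCoord G g y := by
  have : ∀ k, ∀ z ∈ U, partialD k f z = partialD k g z :=
    fun k z hz => partialD_congr_on k hU hz h
  unfold laplacianCoord hessianCoord
  simp only [this _ y hy, fun i j => partialD_congr_on i hU hy (this j)]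

/-- Supplies the differentiability of `h` and of `|∇h|²`, whose regularity is first obtained in the
chart. -/
theorem mdifferentiableAt_of_comp_extChartAt_symm [IsManifold (𝓡 n) ∞ M] {x p : M}
    (hp : p ∈ (extChartAt (𝓡 n) x).source) {F : M → ℝ}
    (hF : DifferentiableAt ℝ (F ∘ (extChartAt (𝓡 n) x).symm) (extChartAt (𝓡 n) x p)) :
    MDifferentiableAt (𝓡 n) 𝓘(ℝ, ℝ) F p := by
  have := isManifold_one (n := n) (M := M)
  have h : MDifferentiableAt (𝓡 n) 𝓘(ℝ, ℝ)
      ((F ∘ (extChartAt (𝓡 n) x).symm) ∘ extChartAt (𝓡 n) x) p :=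
    hF.mdifferentiableAt.comp p (mdifferentiableAt_extChartAt (by simpa using hp))
  refine h.congr_of_eventuallyEq (Filter.eventuallyEq_of_mem
    ((isOpen_extChartAt_source (I := 𝓡 n) x).mem_nhds hp) fun w hw => ?_)
  simp only [Function.comp]
  rw [(extChartAt (𝓡 n) x).left_inv hw]

variable [RiemannianBundle (fun x : M => TangentSpace (𝓡 n) x)] [IsManifold (𝓡 n) ∞ M]
  [IsContMDiffRiemannianBundle (𝓡 n) ∞ (EuclideanSpace ℝ (Fin n))
    (fun x : M => TangentSpace (𝓡 n) x)]

theorem half_laplacian_norm_grad_sq_ge (hn : 0 < n) {Ω : Set M} (hΩ : IsOpen Ω)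
    {α ε c K C₁ : ℝ} (hε : ε ∈ Set.Ioo (0 : ℝ) 1)
    (hRic : ∀ x ∈ Ω, ∀ v : TangentSpace (𝓡 n) x, -K * inner ℝ v v ≤ ricci x v v)
    {u : M → ℝ} (hu : ContMDiffOn (𝓡 n) 𝓘(ℝ, ℝ) 3 u Ω) (hpos : ∀ x ∈ Ω, 0 < u x)
    (heq : ∀ x ∈ Ω, laplacian n u x + c * u x ^ α = 0) {h : M → ℝ}
    (hh : ∀ x ∈ Ω, h x = u x ^ ε) {x : M} (hx : x ∈ Ω)
    (hquad : ∀ X : ℝ, 0 ≤ X → C₁ * X ^ 2 ≤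
      (ε * (c * u x ^ (α - 1)) + (1 - ε) / ε * X) ^ 2 / n
        - (α + ε - 1) * (c * u x ^ (α - 1)) * X + (1 - ε) / ε * X ^ 2) :
    C₁ * (‖grad n h x‖ ^ 4 / h x ^ 2)
        - (1 - ε) / ε * inner ℝ ((h x)⁻¹ • grad n h x) (grad n (fun y => ‖grad n h y‖ ^ 2) x)
        - K * ‖grad n h x‖ ^ 2
      ≤ (1 / 2) * laplacian n (fun y => ‖grad n h y‖ ^ 2) x := by
  set φ := (extChartAt (𝓡 n) x).symm
  set y := extChartAt (𝓡 n) x x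
  set G := chartMetric n x
  set U := (extChartAt (𝓡 n) x).target ∩ φ ⁻¹' Ω
  have hU : IsOpen U := isOpen_target_inter_preimage hΩ x
  have hφy : φ y = x := extChartAt_to_inv x
  have hy : y ∈ U := ⟨mem_extChartAt_target x, by rw [Set.mem_preimage, hφy]; exact hx⟩
  have hG : IsMetricOn G U := (isMetricOn_chartMetric x).mono hU Set.inter_subset_left
  have huC : ContDiffOn ℝ 3 (u ∘ φ) U :=
    contDiffOn_comp_extChartAt_symm (WithTop.coe_le_coe.2 le_top) hu x
  have hhC : ContDiffOn ℝ 3 (h ∘ φ) U :=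
    (huC.rpow_const_of_ne fun z hz => (hpos _ hz.2).ne').congr fun z hz => hh _ hz.2
  have hhd : ∀ z ∈ U, MDifferentiableAt (𝓡 n) 𝓘(ℝ, ℝ) h (φ z) := by
    intro z hz
    refine mdifferentiableAt_of_comp_extChartAt_symm ((extChartAt (𝓡 n) x).map_target hz.1) ?_
    rw [(extChartAt (𝓡 n) x).right_inv hz.1]
    exact (hhC.contDiffAt (hU.mem_nhds hz)).differentiableAt (by simp)
  set P : M → ℝ := fun y => ‖grad n h y‖ ^ 2 with hP
  have hPφ : ∀ z ∈ U, (P ∘ φ) z = innerGradCoord G (h ∘ φ) (h ∘ φ) z := by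
    intro z hz
    rw [← inner_grad_grad hz.1 (hhd z hz) (hhd z hz), real_inner_self_eq_norm_sq]
    rfl
  have hPC : ContDiffOn ℝ 2 (P ∘ φ) U :=
    (hG.contDiffOn_innerGradCoord hhC hhC (by norm_num) (WithTop.coe_le_coe.2 le_top)).congr hPφ
  have hPd : MDifferentiableAt (𝓡 n) 𝓘(ℝ, ℝ) P (φ y) := by
    refine mdifferentiableAt_of_comp_extChartAt_symm ((extChartAt (𝓡 n) x).map_target hy.1) ?_
    rw [(extChartAt (𝓡 n) x).right_inv hy.1]
    exact (hPC.contDiffAt (hU.mem_nhds hy)).differentiableAt (by simp)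
  have hPx : P x = innerGradCoord G (h ∘ φ) (h ∘ φ) y := by
    rw [← hPφ y hy, Function.comp, hφy]
  have hinner : inner ℝ (grad n h x) (grad n P x)
      = innerGradCoord G (h ∘ φ) (innerGradCoord G (h ∘ φ) (h ∘ φ)) y := by
    have h1 : ∀ p, p = x →
        inner ℝ (grad n h p) (grad n P p) = inner ℝ (grad n h x) (grad n P x) := by
      rintro _ rfl
      rfl
    rw [← h1 _ hφy, inner_grad_grad hy.1 (hhd y hy) hPd]
    unfold innerGradCoord
    refine Finset.sum_congr rfl fun i _ => Finset.sum_congr rfl fun j _ => ?_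
    rw [partialD_congr_on j hU hy hPφ]
    rfl
  have hlap : laplacian n P x
      = laplacianCoord G (innerGradCoord G (h ∘ φ) (h ∘ φ)) y :=
    laplacianCoord_congr_on hU hy hPφ
  have hric := hRic x hx (grad n h x)
  rw [real_inner_self_eq_norm_sq, show ‖grad n h x‖ ^ 2 = P x from rfl, hPx, ricci] at hric
  have hhx : MDifferentiableAt (𝓡 n) 𝓘(ℝ, ℝ) h x := by
    have := hhd y hy
    rwa [hφy] at this
  simp only [tangentCoord_grad hhx] at hric
  have hmain := hG.half_laplacianCoord_innerGradCoord_ge hn (w := u ∘ φ) (h := h ∘ φ) (c := c)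
    (α := α) (K := K) (C₁ := C₁) hε huC (fun z hz => hpos _ hz.2)
    -- The equation is needed on all of `U` in the chart around `x`, hence the chart independence of
    -- the Laplacian.
    (fun z hz => by
      rw [← laplacian_eq_laplacianCoord hΩ (hu.of_le (by norm_num)) hz]
      exact heq _ hz.2)
    (fun z hz => hh _ hz.2) hy hric (by
      rw [Function.comp, hφy]
      exact hquad)
  rw [real_inner_smul_left, hinner, hlap, show ‖grad n h x‖ ^ 4 = P x ^ 2 by rw [hP]; ring,
    show ‖grad n h x‖ ^ 2 = P x from rfl, hPx]
  have hhy : (h ∘ φ) y = h x := by rw [Function.comp, hφy]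
  rwa [hhy] at hmain

end Manifold

end RiemGeom

/-! ### The main theorem. -/

theorem proposition2p3 (n : ℕ) (α : ℝ) :
    ∃ ε ∈ Set.Ioo (0 : ℝ) 1, ∃ C₁ : ℝ, 0 < C₁ ∧ ∃ C₂ : ℝ, 0 < C₂ ∧
      ∀ (M : Type*) [TopologicalSpace M] [ChartedSpace (EuclideanSpace ℝ (Fin n)) M]
        [IsManifold (𝓡 n) ∞ M]
        [RiemannianBundle (fun x : M => TangentSpace (𝓡 n) x)]
        [IsContMDiffRiemannianBundle (𝓡 n) ∞ (EuclideanSpace ℝ (Fin n))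
          (fun x : M => TangentSpace (𝓡 n) x)]
        (Ω : Set M) (_ : IsOpen Ω) (c K : ℝ) (_ : 0 ≤ K)
        (_ : (c < 0 ∧ 0 < α) ∨
          (0 < c ∧ 3 ≤ n ∧ ((n : ℝ) + 2) / (2 * ((n : ℝ) - 1)) < α ∧
            α < (2 * (n : ℝ) ^ 2 + 9 * (n : ℝ) + 6) / (2 * (n : ℝ) * ((n : ℝ) + 2))))
        (_ : ∀ x ∈ Ω, ∀ v : TangentSpace (𝓡 n) x,
          -K * inner ℝ v v ≤ RiemGeom.ricci x v v)
        (u : M → ℝ) (_ : ContMDiffOn (𝓡 n) 𝓘(ℝ, ℝ) 3 u Ω) (_ : ∀ x ∈ Ω, 0 < u x)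
        (_ : ∀ x ∈ Ω, RiemGeom.laplacian n u x + c * u x ^ α = 0)
        (h : M → ℝ) (_ : ∀ x ∈ Ω, h x = u x ^ ε),
        ∀ x ∈ Ω,
          (1 / 2) * RiemGeom.laplacian n (fun y => ‖RiemGeom.grad n h y‖ ^ 2) x ≥
            C₁ * (‖RiemGeom.grad n h x‖ ^ 4 / h x ^ 2)
              - C₂ * inner ℝ ((h x)⁻¹ • RiemGeom.grad n h x)
                  (RiemGeom.grad n (fun y => ‖RiemGeom.grad n h y‖ ^ 2) x)
              - K * ‖RiemGeom.grad n h x‖ ^ 2 := by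
  rcases Nat.eq_zero_or_pos n with rfl | hn
  -- In dimension zero gradients and Laplacians vanish, so any constants serve.
  · refine ⟨1 / 2, by norm_num, 1, one_pos, 1, one_pos, ?_⟩
    intro M _ _ _ _ _ Ω _ c K _ _ _ u _ _ _ h _ x _
    have hgrad : ∀ (f : M → ℝ) (x : M), RiemGeom.grad 0 f x = 0 := fun f x =>
      Subsingleton.elim (α := EuclideanSpace ℝ (Fin 0)) _ _
    simp [hgrad, RiemGeom.laplacian, RiemGeom.laplacianCoord]
  · obtain ⟨ε, hε, hquad⟩ := RiemGeom.exists_exponent hn α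
    have ha : 0 < (1 - ε) / ε := div_pos (sub_pos.2 hε.2) hε.1
    -- Both constants are `(1 - ε) / ε`.
    refine ⟨ε, hε, _, ha, _, ha, ?_⟩
    intro M _ _ _ _ _ Ω hΩ c K _ hc hRic u hu hpos heq h hh x hx
    exact RiemGeom.half_laplacian_norm_grad_sq_ge hn hΩ hε hRic hu hpos heq hh hx fun X hX =>
      hquad c _ X (Real.rpow_pos_of_pos (hpos x hx) _) hX hc
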